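/- Let $k$ be a real number with $k\neq 0$ and $k\neq -1$. On the $(u,v)$ plane let $$g=\begin{pmatrix}-3u^2+v^2+6u+9 & -4uv-6v\\ -4uv-6v & -3v^2+u^2-6u+9\end{pmatrix},\qquad \sigma=(u^2+v^2)^2-8(u^3-3uv^2)+18(u^2+v^2)-27,$$ let $D=\{\sigma<0\}$ be the interior of the deltoid, and let $\Delta$ and $\nabla$ be the Laplace–Beltrami operator and the gradient of the contravariant metric $g$. Let $\mathfrak a_2$ be the Lie algebra spanned by $\partial_u,\partial_v,u\partial_u,u\partial_v,v\partial_u,v\partial_v$. A second-order operator is called Lie-algebraic over a Lie algebra spanned by first-order operators $T_a$ if it equals $\sum_{a,b} C^{ab}T_aT_b+\sum_a B^aT_a$ with real constants $C^{ab}=C^{ba}$, $B^a$. Then: 1. $\mathfrak a_2$ is a Lie algebra that acts primitively: on no nonempty open subset of the plane does it leave a one-dimensional foliation invariant. 2. $D$ is open and connected, $g$ is positive definite on $D$, and its Gaussian curvature vanishes on $D$. 3. $\mathcal H_0=-\Delta+k\,\nabla\log|\sigma|$ is Lie-algebraic over $\mathfrak a_2$ on $D$. With $\mu=|\sigma|^{k/2}$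 one has $\mu^{-1}\circ\mathcal H_0\circ\mu=-\Delta+U$, where $$U=-12k^2-12k(1+k)(u-\sqrt3\,v-3)(u+\sqrt3\,v-3)(2u+3)\,\sigma^{-1}.$$ The operator $\mathcal H=-\Delta+U$ is Lie-algebraic over the gauge-transformed operators $\mu^{-1}\circ T\circ\mu$, $T\in\mathfrak a_2$. 4. In the plane with affine coordinates $(L_1,L_2)$ and flat contravariant metric $\pi^{-2}\begin{pmatrix}1&-1/2\\-1/2&1\end{pmatrix}$, put $L_3=-L_1-L_2$ and $u+iv=e^{2\pi iL_1}+e^{2\pi iL_2}+e^{2\pi iL_3}$. The push-forward of the flat metric under $(L_1,L_2)\mapsto(u,v)$ is $g$; this map sends the set where $\sin(\pi L_1-\pi L_2)$, $\sin(2\pi L_1+\pi L_2)$ and $\sin(\pi L_1+2\pi L_2)$ are all nonzero onto $D$, and on that set $U$ becomes the trigonometric Olshanetsky–Perelomov potential of type $A_2$, $$U=-12k^2+3k(1+k)\left[\frac1{\sin^2(\pi L_1-\pi L_2)}+\frac1{\sin^2(2\pi L_1+\pi L_2)}+\frac1{\sin^2(\pi L_1+2\pi L_2)}\right].$$ 5.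 On no nonempty open set does this potential separate in a coordinate system of one of the four types, based on any Cartesian coordinates $(x,y)$ of the flat $(L_1,L_2)$ plane (arbitrary origin, orthogonal axes and common unit of length): it has none of the forms $f_1(x)+f_2(y)$; $r^{-2}[f_1(r)+f_2(\theta)]$ in polar coordinates; $(p^2+q^2)^{-1}[f_1(p)+f_2(q)]$ in parabolic coordinates $x=(p^2-q^2)/2,\ y=pq$; $(\cosh^2\xi-\cos^2\eta)^{-1}[f_1(\xi)+f_2(\eta)]$ in elliptic coordinates $x=\cosh\xi\cos\eta,\ y=\sinh\xi\sin\eta$. 6. The Schrödinger equation $-\Delta\psi+U\psi=E\psi$ (in the flat $(L_1,L_2)$ plane as well as on $D$) cannot be solved by separation of variables: on no nonempty open set is there an orthogonal coordinate system $(q_1,q_2)$ such that for every real $E$, after multiplication by a nowhere vanishing function $R$, the substitution $\psi=A(q_1)B(q_2)$ turns $R\,(-\Delta\psi+U\psi-E\psi)$ into $(\ell_1A)(q_1)\,B(q_2)+A(q_1)\,(\ell_2B)(q_2)$ with linear second-order ordinary differential expressions $\ell_1$ in $q_1$ and $\ell_2$ in $q_2$ ($R,\ell_1,\ell_2$ may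 depend on $E$). 7. Consequently Turbiner's conjecture is false, even for operators on connected open subsets of $\mathbb R^2$: it is not true that every Lie-algebraic Schrödinger operator whose symbol defines a Riemannian metric of zero Gaussian curvature can be solved by separation of variables in the sense of 6, not even on some nonempty open subset of its domain. -/

import Mathlib

open scoped ContDiff Matrix

noncomputable section

/-- The coordinate plane. Only its topology and its smooth structure are used (never the sup norm);
metrics are given explicitly below. -/
abbrev Plane : Type := Fin 2 → ℝ

/-- The partial derivative `∂ᵢ f`. -/
def pd (i : Fin 2) (f : Plane → ℝ) : Plane → ℝ :=
  fun p => fderiv ℝ f p (Pi.single i 1)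

/-! ### Metric geometry of a contravariant metric tensor `g = (g^{ij})` -/

/-- The covariant tensor `g_{ij}`. -/
def covariantMetric (g : Plane → Matrix (Fin 2) (Fin 2) ℝ) (i j : Fin 2) : Plane → ℝ :=
  fun p => (g p)⁻¹ i j

/-- The Christoffel symbol `Γ^k_{ij}` of the Levi-Civita connection. -/
def christoffel (g : Plane → Matrix (Fin 2) (Fin 2) ℝ) (k i j : Fin 2) : Plane → ℝ :=
  fun p => (1 / 2) * ∑ l, g p k l *
    (pd i (covariantMetric g j l) p + pd j (covariantMetric g i l) p
      - pd l (covariantMetric g i j) p)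

/-- The component `R^l_{kij}` of the curvature tensor, `R(∂ᵢ, ∂ⱼ) ∂ₖ = ∑ₗ R^l_{kij} ∂ₗ`. -/
def riemann (g : Plane → Matrix (Fin 2) (Fin 2) ℝ) (l k i j : Fin 2) : Plane → ℝ :=
  fun p => pd i (christoffel g l j k) p - pd j (christoffel g l i k) p
    + ∑ m, (christoffel g l i m p * christoffel g m j k p
      - christoffel g l j m p * christoffel g m i k p)

/-- The Gaussian curvature `⟨R(∂₀, ∂₁) ∂₁, ∂₀⟩ / det (g_{ij})`. -/
def gaussianCurvature (g : Plane → Matrix (Fin 2) (Fin 2) ℝ) : Plane → ℝ :=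
  fun p => (∑ l, covariantMetric g 0 l p * riemann g l 1 0 1 p) / ((g p)⁻¹).det

/-- The metric is flat on `D`: its Gaussian curvature vanishes there. -/
def IsFlatOn (D : Set Plane) (g : Plane → Matrix (Fin 2) (Fin 2) ℝ) : Prop :=
  ∀ p ∈ D, gaussianCurvature g p = 0

/-- The Laplace-Beltrami operator `∑ g^{ij} (∂ᵢ∂ⱼ - ∑ₖ Γ^k_{ij} ∂ₖ)`. -/
def laplaceBeltrami (g : Plane → Matrix (Fin 2) (Fin 2) ℝ) (f : Plane → ℝ) : Plane → ℝ :=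
  fun p => ∑ i, ∑ j, g p i j * (pd i (pd j f) p - ∑ k, christoffel g k i j p * pd k f p)

/-- The gradient vector field of `φ`, applied to `f`: `∑ g^{ij} ∂ᵢφ ∂ⱼf`. -/
def gradientOp (g : Plane → Matrix (Fin 2) (Fin 2) ℝ) (φ f : Plane → ℝ) : Plane → ℝ :=
  fun p => ∑ i, ∑ j, g p i j * pd i φ p * pd j f p

/-- The Schrödinger operator `-Δ + U`. -/
def schrodinger (g : Plane → Matrix (Fin 2) (Fin 2) ℝ) (U : Plane → ℝ) (f : Plane → ℝ) :
    Plane → ℝ :=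
  fun p => - laplaceBeltrami g f p + U p * f p

/-! ### Lie-algebraic operators -/

/-- A first order differential operator `∑ᵢ vecᵢ ∂ᵢ + fn`. -/
structure FirstOrderOp where
  vec : Fin 2 → Plane → ℝ
  fn : Plane → ℝ

/-- The action of a first order differential operator on functions. -/
def FirstOrderOp.apply (T : FirstOrderOp) (f : Plane → ℝ) : Plane → ℝ :=
  fun p => ∑ i, T.vec i p * pd i f p + T.fn p * f p

/-- The gauge transform `μ⁻¹ ∘ T ∘ μ` of a first order differential operator. -/
def FirstOrderOp.gauge (μ : Plane → ℝ) (T : FirstOrderOp) : FirstOrderOp where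
  vec := T.vec
  fn := fun p => T.fn p + (∑ i, T.vec i p * pd i μ p) / μ p

/-- The span of the operators `T a`, with smooth coefficients on `D`, is closed under commutators,
i.e. it is a finite-dimensional Lie algebra of first order differential operators on `D`. -/
def GeneratesLieAlgebra (D : Set Plane) {n : ℕ} (T : Fin n → FirstOrderOp) : Prop :=
  (∀ a, (∀ i, ContDiffOn ℝ ∞ ((T a).vec i) D) ∧ ContDiffOn ℝ ∞ (T a).fn D) ∧
  ∃ c : Fin n → Fin n → Fin n → ℝ, ∀ a b, ∀ f : Plane → ℝ, ContDiffOn ℝ ∞ f D → ∀ p ∈ D,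
    (T a).apply ((T b).apply f) p - (T b).apply ((T a).apply f) p
      = ∑ d, c a b d * (T d).apply f p

/-- On `D`, the operator `H` is Lie-algebraic with generators `T a`:
`H = ∑ C^{ab} T_a T_b + ∑ B^a T_a` with real constants `C^{ab} = C^{ba}` and `B^a`,
the `T a` spanning a Lie algebra of first order differential operators. -/
def IsLieAlgebraicOver (D : Set Plane) {n : ℕ} (T : Fin n → FirstOrderOp)
    (H : (Plane → ℝ) → Plane → ℝ) : Prop :=
  GeneratesLieAlgebra D T ∧
  ∃ (C : Fin n → Fin n → ℝ) (B : Fin n → ℝ), (∀ a b, C a b = C b a) ∧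
    ∀ f : Plane → ℝ, ContDiffOn ℝ ∞ f D → ∀ p ∈ D,
      H f p = ∑ a, ∑ b, C a b * (T a).apply ((T b).apply f) p + ∑ a, B a * (T a).apply f p

/-! ### Foliations and imprimitivity -/

/-- On the open set `W`, the leaves of the foliation with tangent lines `L` are the level sets of
the smooth function `lam`, which has no critical points. -/
def IsLeafFunction (L : Plane → Submodule ℝ Plane) (W : Set Plane) (lam : Plane → ℝ) : Prop :=
  IsOpen W ∧ ContDiffOn ℝ ∞ lam W ∧
    ∀ q ∈ W, fderiv ℝ lam q ≠ 0 ∧ LinearMap.ker (fderiv ℝ lam q).toLinearMap = L q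

/-- The field of lines `L` is tangent to a smooth one-dimensional foliation of `D`. -/
def IsFoliationOn (D : Set Plane) (L : Plane → Submodule ℝ Plane) : Prop :=
  ∀ p ∈ D, ∃ W ⊆ D, p ∈ W ∧ ∃ lam, IsLeafFunction L W lam

/-- Two functions of two variables are functionally dependent on `W`: their Jacobian vanishes. -/
def FunctionallyDependentOn (W : Set Plane) (f h : Plane → ℝ) : Prop :=
  ∀ p ∈ W, pd 0 f p * pd 1 h p - pd 1 f p * pd 0 h p = 0

/-- The operators `T a` act imprimitively on `D`: there is a foliation of `D` such that for every
locally defined function `lam` whose level sets are the leaves, `T a (lam)` and `lam` are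
functionally dependent for all `a`. -/
def ActsImprimitivelyOn (D : Set Plane) {n : ℕ} (T : Fin n → FirstOrderOp) : Prop :=
  ∃ L, IsFoliationOn D L ∧ ∀ W ⊆ D, ∀ lam, IsLeafFunction L W lam →
    ∀ a, FunctionallyDependentOn W ((T a).apply lam) lam

/-! ### Separation of variables -/

/-- `q = (q₀, q₁)` is an orthogonal coordinate system on the open set `W`. -/
def IsOrthogonalCoordinateSystem (g : Plane → Matrix (Fin 2) (Fin 2) ℝ) (W : Set Plane)
    (q : Fin 2 → Plane → ℝ) : Prop :=
  IsOpen W ∧ (∀ i, ContDiffOn ℝ ∞ (q i) W) ∧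
  Set.InjOn (fun p => (fun i => q i p : Plane)) W ∧
  (∀ p ∈ W, pd 0 (q 0) p * pd 1 (q 1) p - pd 1 (q 0) p * pd 0 (q 1) p ≠ 0) ∧
  (∀ p ∈ W, gradientOp g (q 0) (q 1) p = 0)

/-- The equation `H ψ = E ψ` separates in the coordinates `q` on `W`: after multiplication by a
nowhere vanishing factor `R`, the substitution `ψ = A(q₀) B(q₁)` splits it into ordinary
differential expressions,
`R (H ψ - E ψ) = (a₀ A'' + b₀ A' + c₀ A)(q₀) B(q₁) + A(q₀) (a₁ B'' + b₁ B' + c₁ B)(q₁)`,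
where `aᵢ, bᵢ, cᵢ` are functions of the single variable `qᵢ`. -/
def EquationSeparatesIn (W : Set Plane) (q : Fin 2 → Plane → ℝ)
    (H : (Plane → ℝ) → Plane → ℝ) (E : ℝ) : Prop :=
  ∃ (R : Plane → ℝ) (a b c : Fin 2 → ℝ → ℝ), (∀ p ∈ W, R p ≠ 0) ∧
    ∀ A B : ℝ → ℝ, ContDiff ℝ ∞ A → ContDiff ℝ ∞ B → ∀ p ∈ W,
      R p * (H (fun x => A (q 0 x) * B (q 1 x)) p - E * (A (q 0 p) * B (q 1 p)))
        = (a 0 (q 0 p) * deriv (deriv A) (q 0 p) + b 0 (q 0 p) * deriv A (q 0 p)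
              + c 0 (q 0 p) * A (q 0 p)) * B (q 1 p)
          + A (q 0 p) * (a 1 (q 1 p) * deriv (deriv B) (q 1 p) + b 1 (q 1 p) * deriv B (q 1 p)
              + c 1 (q 1 p) * B (q 1 p))

/-- The spectral equation `-Δψ + Uψ = Eψ` on `D` can be solved by separation of variables, at
least locally: on some nonempty open part of `D` there is an orthogonal coordinate system in
which it separates for all values of the spectral parameter `E`. -/
def SolvableBySeparation (D : Set Plane) (g : Plane → Matrix (Fin 2) (Fin 2) ℝ)
    (U : Plane → ℝ) : Prop :=
  ∃ W ⊆ D, W.Nonempty ∧ ∃ q, IsOrthogonalCoordinateSystem g W q ∧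
    ∀ E : ℝ, EquationSeparatesIn W q (schrodinger g U) E

/-- Turbiner's conjecture, for operators whose domain is a connected open set in the coordinate
plane: a Lie-algebraic Schrödinger operator whose symbol gives a Riemannian metric of zero Gaussian
curvature can be solved by separation of variables. -/
def TurbinerConjecture : Prop :=
  ∀ (D : Set Plane) (g : Plane → Matrix (Fin 2) (Fin 2) ℝ) (U : Plane → ℝ)
    (n : ℕ) (T : Fin n → FirstOrderOp),
    IsOpen D → IsConnected D →
    (∀ i j, ContDiffOn ℝ ∞ (fun p => g p i j) D) → (∀ p ∈ D, (g p).PosDef) →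
    ContDiffOn ℝ ∞ U D →
    IsLieAlgebraicOver D T (schrodinger g U) →
    IsFlatOn D g →
    SolvableBySeparation D g U

/-- The four types of separating coordinate systems of the Euclidean plane. -/
inductive CoordinateType
  | cartesian
  | polar
  | parabolic
  | elliptic

/-- The Cartesian coordinates `(x, y)` in terms of the given coordinates. -/
def CoordinateType.chart : CoordinateType → Plane → Plane
  | .cartesian, q => q
  | .polar, q => ![q 0 * Real.cos (q 1), q 0 * Real.sin (q 1)]
  | .parabolic, q => ![(q 0 ^ 2 - q 1 ^ 2) / 2, q 0 * q 1]
  | .elliptic, q => ![Real.cosh (q 0) * Real.cos (q 1), Real.sinh (q 0) * Real.sin (q 1)]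

/-- The weight of each type: a separating function has the form `weight⁻¹ (f₁ + f₂)`. -/
def CoordinateType.weight : CoordinateType → Plane → ℝ
  | .cartesian, _ => 1
  | .polar, q => q 0 ^ 2
  | .parabolic, q => q 0 ^ 2 + q 1 ^ 2
  | .elliptic, q => Real.cosh (q 0) ^ 2 - Real.cos (q 1) ^ 2

/-- The function `V` on `S` separates, at least locally, in some coordinate system of type `κ`, for
the flat geometry on the plane given by the constant contravariant metric `G`. The underlying
Cartesian coordinates `x`, with arbitrary origin, axes and unit of length, are given by `t + M x`
with `M Mᵀ = s² G`, `s > 0`; separation is asked for on a nonempty open set `O` of values of the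
coordinates only. -/
def SeparatesInType (κ : CoordinateType) (G : Matrix (Fin 2) (Fin 2) ℝ) (S : Set Plane)
    (V : Plane → ℝ) : Prop :=
  ∃ (s : ℝ) (t : Plane) (M : Matrix (Fin 2) (Fin 2) ℝ), 0 < s ∧ M * Mᵀ = s ^ 2 • G ∧
    ∃ O : Set Plane, IsOpen O ∧ O.Nonempty ∧
      (∀ q ∈ O, κ.weight q ≠ 0 ∧ t + M *ᵥ κ.chart q ∈ S) ∧
      ∃ f₁ f₂ : ℝ → ℝ, ∀ q ∈ O,
        V (t + M *ᵥ κ.chart q) = (κ.weight q)⁻¹ * (f₁ (q 0) + f₂ (q 1))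

/-! ### The trigonometric `A₂` Hamiltonian -/

/-- The generators `∂_u, ∂_v, u∂_u, u∂_v, v∂_u, v∂_v` of the affine Lie algebra `a₂`. -/
def affineGenerators : Fin 6 → FirstOrderOp :=
  ![⟨![fun _ => 1, fun _ => 0], fun _ => 0⟩,
    ⟨![fun _ => 0, fun _ => 1], fun _ => 0⟩,
    ⟨![fun p => p 0, fun _ => 0], fun _ => 0⟩,
    ⟨![fun _ => 0, fun p => p 0], fun _ => 0⟩,
    ⟨![fun p => p 1, fun _ => 0], fun _ => 0⟩,
    ⟨![fun _ => 0, fun p => p 1], fun _ => 0⟩]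

/-- The deltoid metric (contravariant) in the coordinates `(u, v)`. -/
def deltoidMetric (p : Plane) : Matrix (Fin 2) (Fin 2) ℝ :=
  !![-3 * p 0 ^ 2 + p 1 ^ 2 + 6 * p 0 + 9, -4 * p 0 * p 1 - 6 * p 1;
     -4 * p 0 * p 1 - 6 * p 1, -3 * p 1 ^ 2 + p 0 ^ 2 - 6 * p 0 + 9]

/-- The polynomial `σ` whose zero set is the deltoid. -/
def deltoidPoly (p : Plane) : ℝ :=
  (p 0 ^ 2 + p 1 ^ 2) ^ 2 - 8 * (p 0 ^ 3 - 3 * p 0 * p 1 ^ 2) + 18 * (p 0 ^ 2 + p 1 ^ 2) - 27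

/-- The interior of the deltoid. -/
def deltoidDomain : Set Plane := {p | deltoidPoly p < 0}

/-- The operator `H₀ = -Δ + k ∇ log |σ|`. -/
def hamiltonianZero (k : ℝ) (f : Plane → ℝ) : Plane → ℝ :=
  fun p => - laplaceBeltrami deltoidMetric f p
    + k * gradientOp deltoidMetric (fun x => Real.log |deltoidPoly x|) f p

/-- The gauge factor `exp ((k/2) log |σ|)`. -/
def gaugeFactor (k : ℝ) : Plane → ℝ :=
  fun p => Real.exp (k / 2 * Real.log |deltoidPoly p|)

/-- The potential in the coordinates `(u, v)`. -/
def potentialUV (k : ℝ) (p : Plane) : ℝ :=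
  -12 * k ^ 2 - 12 * k * (1 + k) * (p 0 - √3 * p 1 - 3) * (p 0 + √3 * p 1 - 3) * (2 * p 0 + 3)
    * (deltoidPoly p)⁻¹

/-- The potential in the affine coordinates `(L₁, L₂)`. -/
def potentialL (k : ℝ) (L : Plane) : ℝ :=
  -12 * k ^ 2 + 3 * k * (1 + k) *
    (1 / Real.sin (Real.pi * L 0 - Real.pi * L 1) ^ 2
      + 1 / Real.sin (2 * Real.pi * L 0 + Real.pi * L 1) ^ 2
      + 1 / Real.sin (Real.pi * L 0 + 2 * Real.pi * L 1) ^ 2)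

/-- The domain of the potential in the `(L₁, L₂)` plane: the complement of the mirror lines. -/
def mirrorComplement : Set Plane :=
  {L | Real.sin (Real.pi * L 0 - Real.pi * L 1) ≠ 0 ∧
       Real.sin (2 * Real.pi * L 0 + Real.pi * L 1) ≠ 0 ∧
       Real.sin (Real.pi * L 0 + 2 * Real.pi * L 1) ≠ 0}

/-- The Euclidean metric (contravariant) in the affine coordinates `(L₁, L₂)`, normalised as the
deltoid metric. -/
def weightMetric : Matrix (Fin 2) (Fin 2) ℝ :=
  (1 / Real.pi ^ 2) • !![1, -1 / 2; -1 / 2, 1]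

/-- The real and imaginary parts `(u, v)` of the character `z₁ + z₂ + z₃`, where
`z_j = exp (2πi L_j)` and `L₃ = -L₁ - L₂`. -/
def characterMap (L : Plane) : Plane :=
  let χ : ℂ := Complex.exp (2 * Real.pi * Complex.I * (L 0 : ℂ))
    + Complex.exp (2 * Real.pi * Complex.I * (L 1 : ℂ))
    + Complex.exp (2 * Real.pi * Complex.I * ((-L 0 - L 1 : ℝ) : ℂ))
  ![χ.re, χ.im]

end

/-!
The operators `∂ᵢ` acting on explicit rational functions settle the local claims: `det g = -3σ`,
the Christoffel symbols of `g` are polynomials divided by `σ` with contraction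
`g^{ij} Γ^k_{ij} = 4 (u, v)`, and `g ∇σ = -12 σ (u, v)`. Hence the curvature vanishes, `H₀` is
quadratic in the affine generators, and conjugation by `|σ|^{k/2}` produces the potential `U`.
With `a = π (L₁ + L₂)` and `b = π (L₁ - L₂)` one has `u + iv = 2 cos b e^{ia} + e^{-2ia}` and
`σ = -16 sin² b (cos b - cos 3a)²` (`deltoidPoly_factor`), so that the character map sends the
complement of the mirrors into the deltoid; it is onto because any `u + iv` can be written as
`2x e^{ia} + e^{-2ia}` with real `x` (`exists_angle`).

All statements on non-separability come from one fact, `not_liouville_separable`. In an isotropic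
complex coordinate `z` of the flat plane the potential is, up to constants,
`V = ∑ 1 / sin² (Re (n_j z))` with covectors `n_j` at angles of 60 degrees. Suppose that `z = Z(w)`
is holomorphic and that `|Z'|²` and `|Z'|² V` are both sums of a function of `Re w` and a function of
`Im w`. Vanishing of the mixed derivative of `|Z'|²` says that `Z''' / Z'` is real, hence a constant
`c`, and integration gives `Z'² = P(Z)` with `P(z) = c z² + 2 β z + γ`. Vanishing of the mixed
derivative of `|Z'|² V` then is the Bertrand-Darboux equation `Im (P V_zz + (3/2) P' V_z) = 0`. It is
real analytic after multiplication by powers of the sines, so it holds in the whole plane, and its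
most singular terms show that `Im (n_j² P)` vanishes on every mirror `Re (n_j z) ∈ πℤ`
(`darboux_trivial`). The parallel mirrors `Re z = 0` and `Re z = 2π` leave for `P` only a real
constant, and a mirror of another direction leaves `P = 0`, contrary to `Z' ≠ 0`.

The four classical coordinate systems are of this kind, with `Z` an affine function of `w`,
`± exp w`, `w²/2` or `cosh w` (`not_separatesInType`). If the spectral equation separates in
orthogonal coordinates `q`, then testing on products of polynomials gives `R |∇qᵢ|² = -aᵢ(qᵢ)` and
`R (U - E) = c₀(q₀) + c₁(q₁)`. The multipliers `R` of two values of `E` have constant ratio, so both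
`R` and `R U` are sums of functions of one variable, and the functions `Qᵢ = ∫ |aᵢ|^{-1/2} dqᵢ` are
conformal coordinates (`exists_liouville_rescaling`); `Z` is the local inverse of `Q₀ ± i Q₁`. The
case of the deltoid reduces to the flat plane by pulling back along the character map.
-/

open Topology

/-! ### Calculus of the partial derivatives -/

theorem HasFDerivAt.pd_eq {f : Plane → ℝ} {f' : Plane →L[ℝ] ℝ} {p : Plane}
    (h : HasFDerivAt f f' p) (i : Fin 2) : pd i f p = f' (Pi.single i 1) := by
  rw [pd, h.fderiv]

theorem pd_const (i : Fin 2) (c : ℝ) (p : Plane) : pd i (fun _ => c) p = 0 := by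
  simp [(hasFDerivAt_const c p).pd_eq i]

theorem pd_coord (i j : Fin 2) (p : Plane) : pd i (fun x => x j) p = if i = j then 1 else 0 := by
  rw [(hasFDerivAt_apply j p).pd_eq i]
  simp [Pi.single_apply, eq_comm]

section
variable {f h : Plane → ℝ} {p : Plane}

theorem pd_add (hf : DifferentiableAt ℝ f p) (hh : DifferentiableAt ℝ h p) (i : Fin 2) :
    pd i (fun x => f x + h x) p = pd i f p + pd i h p := by
  rw [(hf.hasFDerivAt.fun_add hh.hasFDerivAt).pd_eq i]; rfl

theorem pd_sub (hf : DifferentiableAt ℝ f p) (hh : DifferentiableAt ℝ h p) (i : Fin 2) :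
    pd i (fun x => f x - h x) p = pd i f p - pd i h p := by
  rw [(hf.hasFDerivAt.fun_sub hh.hasFDerivAt).pd_eq i]; rfl

theorem pd_neg (i : Fin 2) : pd i (fun x => -f x) p = -pd i f p := by
  simp [pd, fderiv_fun_neg]

theorem pd_mul (hf : DifferentiableAt ℝ f p) (hh : DifferentiableAt ℝ h p) (i : Fin 2) :
    pd i (fun x => f x * h x) p = pd i f p * h p + f p * pd i h p := by
  rw [(hf.hasFDerivAt.fun_mul hh.hasFDerivAt).pd_eq i]
  simp [pd]; ring

theorem pd_comp {φ : ℝ → ℝ} {φ' : ℝ} (hφ : HasDerivAt φ φ' (f p)) (hf : DifferentiableAt ℝ f p)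
    (i : Fin 2) : pd i (fun x => φ (f x)) p = φ' * pd i f p := by
  have := (hφ.hasFDerivAt.comp p hf.hasFDerivAt).pd_eq i
  simp only [Function.comp_def] at this
  rw [this]; simp [pd, mul_comm]

theorem pd_pow (hf : DifferentiableAt ℝ f p) (n : ℕ) (i : Fin 2) :
    pd i (fun x => f x ^ n) p = n * f p ^ (n - 1) * pd i f p :=
  pd_comp (hasDerivAt_pow n (f p)) hf i

theorem pd_div (hf : DifferentiableAt ℝ f p) (hh : DifferentiableAt ℝ h p) (h0 : h p ≠ 0)
    (i : Fin 2) :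
    pd i (fun x => f x / h x) p = (pd i f p * h p - f p * pd i h p) / h p ^ 2 := by
  have h1 : DifferentiableAt ℝ (fun x => (h x)⁻¹) p := hh.fun_inv h0
  simp only [div_eq_mul_inv]
  rw [pd_mul hf h1, pd_comp (hasDerivAt_inv h0) hh]
  field_simp
  ring

theorem pd_congr (hfh : f =ᶠ[𝓝 p] h) (i : Fin 2) : pd i f p = pd i h p := by
  rw [pd, pd, hfh.fderiv_eq]

theorem pd_congr_on {D : Set Plane} (hD : IsOpen D) (hfh : ∀ x ∈ D, f x = h x) (hp : p ∈ D)
    (i : Fin 2) : pd i f p = pd i h p :=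
  pd_congr (Filter.eventually_of_mem (hD.mem_nhds hp) hfh) i

theorem ContDiffAt.pd (hf : ContDiffAt ℝ ∞ f p) (i : Fin 2) : ContDiffAt ℝ ∞ (pd i f) p :=
  (hf.fderiv_right (m := ∞) (by simp)).clm_apply contDiffAt_const

theorem ContDiffAt.differentiableAt_infty (hf : ContDiffAt ℝ ∞ f p) : DifferentiableAt ℝ f p :=
  hf.differentiableAt (by simp)

theorem pd_comm (hf : ContDiffAt ℝ ∞ f p) (i j : Fin 2) : pd i (pd j f) p = pd j (pd i f) p := by
  have hd : DifferentiableAt ℝ (fderiv ℝ f) p :=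
    (hf.fderiv_right (m := ∞) (by simp)).differentiableAt (by simp)
  have key : ∀ a b, _root_.pd a (_root_.pd b f) p
      = fderiv ℝ (fderiv ℝ f) p (Pi.single a 1) (Pi.single b 1) := by
    intro a b
    have := (hd.hasFDerivAt.clm_apply (hasFDerivAt_const (Pi.single b 1 : Plane) p)).pd_eq a
    exact this.trans (by simp)
  have hs : IsSymmSndFDerivAt ℝ f p := hf.isSymmSndFDerivAt (by
    simp only [minSmoothness_of_isRCLikeNormedField]
    exact WithTop.coe_le_coe.2 (le_top : (2 : ℕ∞) ≤ ⊤))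
  rw [key, key]
  exact hs _ _

theorem ContDiffOn.contDiffAt_of_isOpen {D : Set Plane} (hf : ContDiffOn ℝ ∞ f D)
    (hD : IsOpen D) (hp : p ∈ D) : ContDiffAt ℝ ∞ f p :=
  hf.contDiffAt (hD.mem_nhds hp)

theorem contDiffOn_pd {D : Set Plane} (hf : ContDiffOn ℝ ∞ f D) (hD : IsOpen D) (i : Fin 2) :
    ContDiffOn ℝ ∞ (pd i f) D :=
  fun _ hx => ((hf.contDiffAt_of_isOpen hD hx).pd i).contDiffWithinAt

end

/-! ### The affine Lie algebra -/

/-- The affine generators are `w a • ∂_(J a)`: this is the coefficient `w a`. -/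
noncomputable def affineCoeff (a : Fin 6) (p : Plane) : ℝ := ![1, 1, p 0, p 0, p 1, p 1] a

/-- The direction of differentiation of an affine generator. -/
def affineDir : Fin 6 → Fin 2 := ![0, 1, 0, 1, 0, 1]

theorem affineGenerators_apply (a : Fin 6) (f : Plane → ℝ) :
    (affineGenerators a).apply f = fun p => affineCoeff a p * pd (affineDir a) f p := by
  funext p
  fin_cases a <;> simp [affineGenerators, FirstOrderOp.apply, affineCoeff, affineDir]

theorem contDiff_affineCoeff (a : Fin 6) : ContDiff ℝ ∞ (affineCoeff a) := by
  have h : affineCoeff a = fun p => affineCoeff a p := rfl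
  fin_cases a <;> rw [h] <;> simp [affineCoeff] <;> fun_prop

/-- The slopes `∂ᵢ (w a)`, which are `0` or `1`. -/
noncomputable def affineSlope (i : Fin 2) (a : Fin 6) : ℝ :=
  ![![0, 0, 1, 1, 0, 0], ![0, 0, 0, 0, 1, 1]] i a

theorem pd_affineCoeff (i : Fin 2) (a : Fin 6) (p : Plane) :
    pd i (affineCoeff a) p = affineSlope i a := by
  have h : affineCoeff a = fun p => affineCoeff a p := rfl
  fin_cases i <;> fin_cases a <;> rw [h] <;>
    simp [affineCoeff, affineSlope, pd_const, pd_coord]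

theorem affineGenerators_apply_apply (a b : Fin 6) {f : Plane → ℝ} {p : Plane}
    (hf : ContDiffAt ℝ ∞ f p) :
    (affineGenerators a).apply ((affineGenerators b).apply f) p =
      affineCoeff a p * (affineSlope (affineDir a) b * pd (affineDir b) f p
        + affineCoeff b p * pd (affineDir a) (pd (affineDir b) f) p) := by
  rw [affineGenerators_apply a, affineGenerators_apply b]
  simp only
  rw [pd_mul ((contDiff_affineCoeff b).contDiffAt.differentiableAt_infty)
    (hf.pd _).differentiableAt_infty, pd_affineCoeff]

/-- The generator with the coefficient of `a` and the direction of `b`. -/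
def affineIndex (a b : Fin 6) : Fin 6 :=
  ![![0, 1], ![0, 1], ![2, 3], ![2, 3], ![4, 5], ![4, 5]] a (affineDir b)

theorem affineIndex_spec (a b : Fin 6) (f : Plane → ℝ) (p : Plane) :
    (affineGenerators (affineIndex a b)).apply f p = affineCoeff a p * pd (affineDir b) f p := by
  rw [affineGenerators_apply]
  fin_cases a <;> fin_cases b <;> rfl

theorem contDiff_affineGenerators_vec (a : Fin 6) (i : Fin 2) :
    ContDiff ℝ ∞ ((affineGenerators a).vec i) := by
  fin_cases a <;> fin_cases i <;> simp [affineGenerators] <;> fun_prop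

theorem affineGenerators_fn (a : Fin 6) : (affineGenerators a).fn = fun _ => 0 := by
  fin_cases a <;> rfl

theorem generatesLieAlgebra_affine {D : Set Plane} (hD : IsOpen D) :
    GeneratesLieAlgebra D affineGenerators := by
  refine ⟨fun a => ⟨fun i => (contDiff_affineGenerators_vec a i).contDiffOn, ?_⟩, ?_⟩
  · rw [affineGenerators_fn]; exact contDiffOn_const
  · refine ⟨fun a b d => (if d = affineIndex a b then affineSlope (affineDir a) b else 0)
      - (if d = affineIndex b a then affineSlope (affineDir b) a else 0), ?_⟩
    intro a b f hf p hp
    have hfp := hf.contDiffAt_of_isOpen hD hp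
    simp only [sub_mul, Finset.sum_sub_distrib, ite_mul, zero_mul, Finset.sum_ite_eq',
      Finset.mem_univ, if_true]
    rw [affineGenerators_apply_apply a b hfp, affineGenerators_apply_apply b a hfp,
      pd_comm hfp (affineDir a), affineIndex_spec, affineIndex_spec]
    ring

/-- Applied to a leaf function `lam`, the fields `u∂_v` and `v∂_u` together with the
translations force `∂_v lam = 0` and `∂_u lam = 0`, whereas leaf functions have no critical
points. -/
theorem not_actsImprimitively_affine {D : Set Plane} (hD' : D.Nonempty) :
    ¬ ActsImprimitivelyOn D affineGenerators := by
  rintro ⟨L, hL, H⟩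
  obtain ⟨p, hp⟩ := hD'
  obtain ⟨W, hWD, hpW, lam, hlam⟩ := hL p hp
  have hW : IsOpen W := hlam.1
  have hsm : ContDiffAt ℝ ∞ lam p := hlam.2.1.contDiffAt_of_isOpen hW hpW
  have key : ∀ a, _ := fun a => H W hWD lam hlam a p hpW
  have hpd : ∀ i a, pd i ((affineGenerators a).apply lam) p =
      affineSlope i a * pd (affineDir a) lam p
        + affineCoeff a p * pd i (pd (affineDir a) lam) p := by
    intro i a
    rw [affineGenerators_apply, pd_mul ((contDiff_affineCoeff a).contDiffAt.differentiableAt_infty)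
      (hsm.pd _).differentiableAt_infty, pd_affineCoeff]
  simp only [hpd] at key
  have k0 := key 0
  have k1 := key 1
  have k3 := key 3
  have k4 := key 4
  simp [affineSlope, affineCoeff, affineDir] at k0 k1 k3 k4
  have hv : pd 1 lam p = 0 := by
    have : pd 1 lam p ^ 2 = 0 := by linear_combination k3 - p 0 * k1
    simpa using this
  have hu : pd 0 lam p = 0 := by
    have : pd 0 lam p ^ 2 = 0 := by linear_combination -k4 + p 1 * k0
    simpa using this
  refine (hlam.2.2 p hpW).1 ?_
  ext x
  have hx : x = x 0 • (Pi.single 0 1 : Plane) + x 1 • (Pi.single 1 1 : Plane) := by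
    ext i; fin_cases i <;> simp
  rw [hx, map_add, map_smul, map_smul]
  simp only [pd] at hu hv
  simp [hu, hv]

/-! ### Geometry of the deltoid metric -/

theorem contDiff_deltoidPoly : ContDiff ℝ ∞ deltoidPoly := by
  unfold deltoidPoly; fun_prop

theorem continuous_deltoidPoly : Continuous deltoidPoly := contDiff_deltoidPoly.continuous

theorem differentiable_deltoidPoly : Differentiable ℝ deltoidPoly :=
  contDiff_deltoidPoly.differentiable (by simp)

theorem isOpen_deltoidDomain : IsOpen deltoidDomain :=
  isOpen_lt continuous_deltoidPoly continuous_const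

theorem pd_zero_deltoidPoly (p : Plane) : pd 0 deltoidPoly p =
    4 * p 0 * (p 0 ^ 2 + p 1 ^ 2) - 24 * (p 0 ^ 2 - p 1 ^ 2) + 36 * p 0 := by
  have h : deltoidPoly = fun p => deltoidPoly p := rfl
  rw [h]
  simp (disch := fun_prop) only [deltoidPoly, pd_add, pd_sub, pd_mul, pd_pow, pd_const, pd_coord]
  simp
  ring

theorem pd_one_deltoidPoly (p : Plane) : pd 1 deltoidPoly p =
    4 * p 1 * (p 0 ^ 2 + p 1 ^ 2) + 48 * p 0 * p 1 + 36 * p 1 := by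
  have h : deltoidPoly = fun p => deltoidPoly p := rfl
  rw [h]
  simp (disch := fun_prop) only [deltoidPoly, pd_add, pd_sub, pd_mul, pd_pow, pd_const, pd_coord]
  simp
  ring

theorem det_deltoidMetric (p : Plane) : (deltoidMetric p).det = -3 * deltoidPoly p := by
  simp only [deltoidMetric, Matrix.det_fin_two_of, deltoidPoly]; ring

theorem deltoidMetric_inv (p : Plane) : (deltoidMetric p)⁻¹ = (-3 * deltoidPoly p)⁻¹ •
    !![deltoidMetric p 1 1, -deltoidMetric p 0 1; -deltoidMetric p 1 0, deltoidMetric p 0 0] := by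
  rw [Matrix.inv_def, Ring.inverse_eq_inv', det_deltoidMetric, Matrix.adjugate_fin_two]

theorem covariantMetric_zero_zero : covariantMetric deltoidMetric 0 0 =
    fun p => (-3 * p 1 ^ 2 + p 0 ^ 2 - 6 * p 0 + 9) / (-3 * deltoidPoly p) := by
  funext p
  rw [covariantMetric, deltoidMetric_inv]
  simp [deltoidMetric]; ring

theorem covariantMetric_zero_one : covariantMetric deltoidMetric 0 1 =
    fun p => (4 * p 0 * p 1 + 6 * p 1) / (-3 * deltoidPoly p) := by
  funext p
  rw [covariantMetric, deltoidMetric_inv]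
  simp [deltoidMetric]; ring

theorem covariantMetric_one_zero : covariantMetric deltoidMetric 1 0 =
    fun p => (4 * p 0 * p 1 + 6 * p 1) / (-3 * deltoidPoly p) := by
  funext p
  rw [covariantMetric, deltoidMetric_inv]
  simp [deltoidMetric]; ring

theorem covariantMetric_one_one : covariantMetric deltoidMetric 1 1 =
    fun p => (-3 * p 0 ^ 2 + p 1 ^ 2 + 6 * p 0 + 9) / (-3 * deltoidPoly p) := by
  funext p
  rw [covariantMetric, deltoidMetric_inv]
  simp [deltoidMetric]; ring

/-- The partial derivatives of a rational function with denominator `-3σ`. -/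
theorem pd_div_deltoidPoly {N : Plane → ℝ} {p : Plane} (hN : DifferentiableAt ℝ N p)
    (hp : deltoidPoly p ≠ 0) (i : Fin 2) :
    pd i (fun x => N x / (-3 * deltoidPoly x)) p =
      (N p * pd i deltoidPoly p - pd i N p * deltoidPoly p) / (3 * deltoidPoly p ^ 2) := by
  have hd := differentiable_deltoidPoly.differentiableAt (x := p)
  rw [pd_div hN (hd.const_mul _) (by simpa using hp), pd_mul (by fun_prop) hd, pd_const]
  field_simp
  ring

/-- The numerators of the Christoffel symbols of the deltoid metric, whose common denominator
is `σ`. -/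
noncomputable def christoffelNum (k i j : Fin 2) (p : Plane) : ℝ :=
  let u := p 0
  let v := p 1
  let a := ![-u ^ 3 + 7 * u ^ 2 - u * v ^ 2 - 15 * u - 9 * v ^ 2 + 9,
    u ^ 2 * v + v ^ 3 - 9 * v]
  let b := ![-u ^ 2 * v - 8 * u * v - v ^ 3 - 3 * v,
    -u ^ 3 + 5 * u ^ 2 - u * v ^ 2 - 3 * u - 3 * v ^ 2 - 9]
  let c := ![u ^ 3 + u ^ 2 + u * v ^ 2 - 9 * u + v ^ 2 - 9,
    -u ^ 2 * v - 16 * u * v - v ^ 3 - 15 * v]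
  ![![a k, b k], ![b k, c k]] i j

theorem pd_covariantMetric {p : Plane} (hp : deltoidPoly p ≠ 0) (i j l : Fin 2) :
    pd i (covariantMetric deltoidMetric j l) p =
      ![![![-6 + 2 * p 0, 4 * p 1], ![4 * p 1, 6 - 6 * p 0]],
        ![![-6 * p 1, 4 * p 0 + 6], ![4 * p 0 + 6, 2 * p 1]]] i j l / (-3 * deltoidPoly p)
      + ![![(-3 * p 1 ^ 2 + p 0 ^ 2 - 6 * p 0 + 9), (4 * p 0 * p 1 + 6 * p 1)],
          ![(4 * p 0 * p 1 + 6 * p 1), (-3 * p 0 ^ 2 + p 1 ^ 2 + 6 * p 0 + 9)]] j l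
        * pd i deltoidPoly p / (3 * deltoidPoly p ^ 2) := by
  fin_cases j <;> fin_cases l <;>
    simp only [Fin.zero_eta, Fin.mk_one, covariantMetric_zero_zero, covariantMetric_zero_one,
      covariantMetric_one_zero, covariantMetric_one_one] <;>
    rw [pd_div_deltoidPoly (by fun_prop) hp] <;>
    fin_cases i <;>
    simp (disch := fun_prop) only [pd_add, pd_sub, pd_mul, pd_pow, pd_const, pd_coord] <;>
    simp <;> field_simp <;> ring

theorem christoffel_deltoidMetric {p : Plane} (hp : deltoidPoly p ≠ 0) (k i j : Fin 2) :
    christoffel deltoidMetric k i j p = christoffelNum k i j p / deltoidPoly p := by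
  have h0 := pd_zero_deltoidPoly p
  have h1 := pd_one_deltoidPoly p
  have hs : deltoidPoly p = (p 0 ^ 2 + p 1 ^ 2) ^ 2 - 8 * (p 0 ^ 3 - 3 * p 0 * p 1 ^ 2)
    + 18 * (p 0 ^ 2 + p 1 ^ 2) - 27 := rfl
  rw [eq_div_iff hp, ← sub_eq_zero]
  simp only [christoffel, pd_covariantMetric hp, Fin.sum_univ_two]
  fin_cases k <;> fin_cases i <;> fin_cases j <;>
    simp [christoffelNum, deltoidMetric, h0, h1] <;>
    field_simp <;> rw [hs] <;> ring

theorem isFlatOn_deltoid : IsFlatOn deltoidDomain deltoidMetric := by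
  intro p hp
  have hp0 : deltoidPoly p ≠ 0 := ne_of_lt hp
  have hd := differentiable_deltoidPoly.differentiableAt (x := p)
  have hpd : ∀ m k i j, pd m (christoffel deltoidMetric k i j) p =
      (pd m (christoffelNum k i j) p * deltoidPoly p
        - christoffelNum k i j p * pd m deltoidPoly p) / deltoidPoly p ^ 2 := by
    intro m k i j
    rw [pd_congr_on isOpen_deltoidDomain (h := fun x => christoffelNum k i j x / deltoidPoly x)
      (fun x hx => christoffel_deltoidMetric (ne_of_lt hx) k i j) hp]
    refine pd_div ?_ hd hp0 m
    have h : christoffelNum k i j = fun x => christoffelNum k i j x := rfl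
    rw [h]
    fin_cases k <;> fin_cases i <;> fin_cases j <;> simp [christoffelNum] <;> fun_prop
  have hN : ∀ k i j, christoffelNum k i j = fun x => christoffelNum k i j x := fun _ _ _ => rfl
  have hs : deltoidPoly p = (p 0 ^ 2 + p 1 ^ 2) ^ 2 - 8 * (p 0 ^ 3 - 3 * p 0 * p 1 ^ 2)
    + 18 * (p 0 ^ 2 + p 1 ^ 2) - 27 := rfl
  have hR : ∀ l, riemann deltoidMetric l 1 0 1 p = 0 := by
    intro l
    simp only [riemann, hpd, christoffel_deltoidMetric hp0, Fin.sum_univ_two,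
      pd_zero_deltoidPoly, pd_one_deltoidPoly]
    rw [hN l 1 1, hN l 0 1]
    fin_cases l <;> simp [christoffelNum] <;>
    simp (disch := fun_prop) only [pd_add, pd_sub, pd_mul, pd_neg, pd_pow, pd_const, pd_coord] <;>
    simp <;> field_simp <;> rw [hs] <;> ring
  simp [gaussianCurvature, hR]

/-- The first order part of the Laplace-Beltrami operator of the deltoid metric is
`-4 (u ∂_u + v ∂_v)`. -/
theorem laplaceBeltrami_deltoid {p : Plane} (hp : deltoidPoly p ≠ 0) (f : Plane → ℝ) :
    laplaceBeltrami deltoidMetric f p =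
      (∑ i, ∑ j, deltoidMetric p i j * pd i (pd j f) p) - 4 * p 0 * pd 0 f p
        - 4 * p 1 * pd 1 f p := by
  have hs : deltoidPoly p = (p 0 ^ 2 + p 1 ^ 2) ^ 2 - 8 * (p 0 ^ 3 - 3 * p 0 * p 1 ^ 2)
    + 18 * (p 0 ^ 2 + p 1 ^ 2) - 27 := rfl
  have hc : ∀ k, ∑ i, ∑ j, deltoidMetric p i j * christoffel deltoidMetric k i j p = 4 * p k := by
    intro k
    simp only [Fin.sum_univ_two, christoffel_deltoidMetric hp]
    fin_cases k <;> simp [christoffelNum, deltoidMetric] <;> field_simp <;> rw [hs] <;> ring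
  have h0 := hc 0
  have h1 := hc 1
  simp only [Fin.sum_univ_two] at h0 h1
  simp only [laplaceBeltrami, Fin.sum_univ_two]
  linear_combination (-pd 0 f p) * h0 + (-pd 1 f p) * h1

/-- `g ∇σ = -12 σ (u, v)`: the deltoid is a characteristic curve of the metric. -/
theorem deltoidMetric_grad_deltoidPoly (p : Plane) (j : Fin 2) :
    ∑ i, deltoidMetric p i j * pd i deltoidPoly p = -12 * deltoidPoly p * p j := by
  rw [Fin.sum_univ_two, pd_zero_deltoidPoly, pd_one_deltoidPoly]
  fin_cases j <;> simp [deltoidMetric, deltoidPoly] <;> ring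

/-! ### The interior of the deltoid -/

/-- The radius `r` and the real part `c` of the cube of `u + iv`. -/
theorem exists_radius (p : Plane) : ∃ r c : ℝ, 0 ≤ r ∧ r ^ 2 = p 0 ^ 2 + p 1 ^ 2 ∧ c ≤ r ^ 3 ∧
    c = p 0 ^ 3 - 3 * p 0 * p 1 ^ 2 := by
  obtain ⟨r, hr, hr2⟩ : ∃ r : ℝ, 0 ≤ r ∧ r ^ 2 = p 0 ^ 2 + p 1 ^ 2 :=
    ⟨√(p 0 ^ 2 + p 1 ^ 2), Real.sqrt_nonneg _, Real.sq_sqrt (by positivity)⟩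
  refine ⟨r, _, hr, hr2, abs_le_of_sq_le_sq' ?_ (by positivity) |>.2, rfl⟩
  have : (r ^ 3) ^ 2 = (p 0 ^ 2 + p 1 ^ 2) ^ 3 := by rw [← hr2]; ring
  rw [this]
  nlinarith [sq_nonneg (3 * p 0 ^ 2 * p 1 - p 1 ^ 3)]

/-- On rays through the origin `σ` is increasing, because `|Re (u+iv)³| ≤ |u+iv|³`; hence the
interior of the deltoid is star-shaped. -/
theorem deltoidPoly_smul_le {p : Plane} (hp : deltoidPoly p < 0) {t : ℝ} (h0 : 0 ≤ t)
    (h1 : t ≤ 1) : deltoidPoly (t • p) < 0 := by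
  obtain ⟨r, c, hr, hr2, hcr, hc⟩ := exists_radius p
  have e1 : deltoidPoly p = r ^ 4 - 8 * c + 18 * r ^ 2 - 27 := by
    simp only [deltoidPoly, hc]; rw [← hr2]; ring
  have e2 : deltoidPoly (t • p) = t ^ 4 * r ^ 4 - 8 * t ^ 3 * c + 18 * t ^ 2 * r ^ 2 - 27 := by
    have : (t • p) 0 ^ 2 + (t • p) 1 ^ 2 = t ^ 2 * r ^ 2 := by
      simp only [Pi.smul_apply, smul_eq_mul]; rw [hr2]; ring
    simp only [deltoidPoly, this]
    simp only [Pi.smul_apply, smul_eq_mul, hc]; ring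
  rw [e1] at hp
  rw [e2]
  have key : 0 ≤ r ^ 4 * (1 - t ^ 4) - 8 * r ^ 3 * (1 - t ^ 3) + 18 * r ^ 2 * (1 - t ^ 2) := by
    have : r ^ 4 * (1 - t ^ 4) - 8 * r ^ 3 * (1 - t ^ 3) + 18 * r ^ 2 * (1 - t ^ 2)
      = r ^ 2 * (1 - t) * (r ^ 2 * (1 + t + t ^ 2 + t ^ 3) - 8 * r * (1 + t + t ^ 2)
        + 18 * (1 + t)) := by ring
    rw [this]
    have h2 : 0 ≤ (r ^ 2 * (1 + t + t ^ 2 + t ^ 3) - 8 * r * (1 + t + t ^ 2)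
        + 18 * (1 + t)) := by
      have hpos : 0 < 1 + t + t ^ 2 + t ^ 3 := by positivity
      have : 0 ≤ (1 + t + t ^ 2 + t ^ 3) * (r ^ 2 * (1 + t + t ^ 2 + t ^ 3)
          - 8 * r * (1 + t + t ^ 2) + 18 * (1 + t)) := by
        have e : (1 + t + t ^ 2 + t ^ 3) * (r ^ 2 * (1 + t + t ^ 2 + t ^ 3)
          - 8 * r * (1 + t + t ^ 2) + 18 * (1 + t)) =
          (r * (1 + t + t ^ 2 + t ^ 3) - 4 * (1 + t + t ^ 2)) ^ 2
          + 2 * (1 - t) ^ 2 * (1 + 4 * t + t ^ 2) := by ring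
        rw [e]; positivity
      exact nonneg_of_mul_nonneg_right this hpos
    have h3 : 0 ≤ 1 - t := by linarith
    positivity
  have h3 : 0 ≤ 1 - t ^ 3 := by
    have : t ^ 3 ≤ 1 := pow_le_one₀ h0 h1
    linarith
  nlinarith [mul_nonneg h3 (sub_nonneg.2 hcr)]

theorem isConnected_deltoidDomain : IsConnected deltoidDomain := by
  have h0 : (0 : Plane) ∈ deltoidDomain := by simp [deltoidDomain, deltoidPoly]
  have hstar : StarConvex ℝ 0 deltoidDomain := by
    rw [starConvex_zero_iff]
    intro p hp a ha0 ha1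
    exact deltoidPoly_smul_le hp ha0 ha1
  exact (hstar.isPathConnected h0).isConnected

theorem deltoidMetric_posDef {p : Plane} (hp : p ∈ deltoidDomain) : (deltoidMetric p).PosDef := by
  have hdet : 0 < (deltoidMetric p).det := by
    rw [det_deltoidMetric]; have : deltoidPoly p < 0 := hp; linarith
  have hr : p 0 ^ 2 + p 1 ^ 2 < 9 := by
    obtain ⟨r, c, hr, hr2, hcr, hc⟩ := exists_radius p
    have e1 : deltoidPoly p = r ^ 4 - 8 * c + 18 * r ^ 2 - 27 := by
      simp only [deltoidPoly, hc]; rw [← hr2]; ring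
    have hp' : deltoidPoly p < 0 := hp
    by_contra h
    have h3 : 3 ≤ r := by nlinarith
    have : 0 ≤ (r - 3) ^ 3 * (r + 1) := by
      have : 0 ≤ r - 3 := by linarith
      positivity
    nlinarith
  rw [Matrix.det_fin_two] at hdet
  have h01 : deltoidMetric p 1 0 = deltoidMetric p 0 1 := rfl
  have htr : 0 < deltoidMetric p 0 0 + deltoidMetric p 1 1 := by
    simp only [deltoidMetric, Matrix.of_apply, Matrix.cons_val_zero, Matrix.cons_val_one]
    nlinarith
  rw [h01] at hdet
  have h00 : 0 < deltoidMetric p 0 0 := by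
    by_contra h
    nlinarith [sq_nonneg (deltoidMetric p 0 1)]
  refine Matrix.PosDef.of_dotProduct_mulVec_pos ?_ ?_
  · ext i j; fin_cases i <;> fin_cases j <;> simp [deltoidMetric]
  · intro x hx
    simp only [star_trivial, dotProduct, Matrix.mulVec, Fin.sum_univ_two, h01]
    refine pos_of_mul_pos_right (a := deltoidMetric p 0 0) ?_ h00.le
    have e : deltoidMetric p 0 0 * (x 0 * (deltoidMetric p 0 0 * x 0 + deltoidMetric p 0 1 * x 1)
        + x 1 * (deltoidMetric p 0 1 * x 0 + deltoidMetric p 1 1 * x 1))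
        = (deltoidMetric p 0 0 * x 0 + deltoidMetric p 0 1 * x 1) ^ 2
          + (deltoidMetric p 0 0 * deltoidMetric p 1 1
            - deltoidMetric p 0 1 * deltoidMetric p 0 1) * x 1 ^ 2 := by ring
    rw [e]
    by_cases h1 : x 1 = 0
    · have h0 : x 0 ≠ 0 := by
        intro h0; apply hx; ext i; fin_cases i <;> simp [h0, h1]
      rw [h1]
      have : 0 < (deltoidMetric p 0 0 * x 0) ^ 2 := by positivity
      simpa using this
    · positivity

/-! ### The Hamiltonian and its gauge transform -/

theorem pd_log_deltoidPoly {p : Plane} (hp : deltoidPoly p ≠ 0) (i : Fin 2) :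
    pd i (fun x => Real.log |deltoidPoly x|) p = pd i deltoidPoly p / deltoidPoly p := by
  simp only [Real.log_abs]
  rw [pd_comp (Real.hasDerivAt_log hp) differentiable_deltoidPoly.differentiableAt]
  field_simp

theorem hamiltonianZero_eq (k : ℝ) {p : Plane} (hp : deltoidPoly p ≠ 0) (f : Plane → ℝ) :
    hamiltonianZero k f p = -(∑ i, ∑ j, deltoidMetric p i j * pd i (pd j f) p)
      + (4 - 12 * k) * (p 0 * pd 0 f p + p 1 * pd 1 f p) := by
  have h0 := deltoidMetric_grad_deltoidPoly p 0
  have h1 := deltoidMetric_grad_deltoidPoly p 1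
  simp only [Fin.sum_univ_two] at h0 h1
  simp only [hamiltonianZero, laplaceBeltrami_deltoid hp, gradientOp, pd_log_deltoidPoly hp,
    Fin.sum_univ_two]
  field_simp
  linear_combination k * pd 0 f p * h0 + k * pd 1 f p * h1

theorem isLieAlgebraicOver_hamiltonianZero (k : ℝ) :
    IsLieAlgebraicOver deltoidDomain affineGenerators (hamiltonianZero k) := by
  refine ⟨generatesLieAlgebra_affine isOpen_deltoidDomain,
    ![![-9, 0, -3, 0, 0, 6], ![0, -9, 0, 3, 0, 0], ![-3, 0, 3, 0, 0, 4],
      ![0, 3, 0, -1, 0, 0], ![0, 0, 0, 0, -1, 0], ![6, 0, 4, 0, 0, 3]],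
    ![3, 0, 1 - 12 * k, 0, 0, 1 - 12 * k], ?_, ?_⟩
  · intro a b
    fin_cases a <;> fin_cases b <;> rfl
  · intro f hf p hp
    have hfp := hf.contDiffAt_of_isOpen isOpen_deltoidDomain hp
    simp only [hamiltonianZero_eq k (ne_of_lt hp), affineGenerators_apply_apply _ _ hfp]
    simp only [affineGenerators_apply]
    simp [Fin.sum_univ_succ, affineCoeff, affineSlope, affineDir, deltoidMetric]
    rw [pd_comm hfp 1 0]
    ring

theorem gaugeFactor_pos (k : ℝ) (p : Plane) : 0 < gaugeFactor k p := Real.exp_pos _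

theorem contDiffOn_log_deltoidPoly :
    ContDiffOn ℝ ∞ (fun x => Real.log |deltoidPoly x|) deltoidDomain := by
  simp only [Real.log_abs]
  exact contDiff_deltoidPoly.contDiffOn.log fun _ hx => ne_of_lt hx

theorem contDiffOn_gaugeFactor (k : ℝ) : ContDiffOn ℝ ∞ (gaugeFactor k) deltoidDomain :=
  (contDiffOn_const.mul contDiffOn_log_deltoidPoly).exp

theorem pd_gaugeFactor (k : ℝ) {p : Plane} (hp : p ∈ deltoidDomain) (i : Fin 2) :
    pd i (gaugeFactor k) p = gaugeFactor k p * (k / 2 * (pd i deltoidPoly p / deltoidPoly p)) := by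
  have hl : DifferentiableAt ℝ (fun x => Real.log |deltoidPoly x|) p :=
    (contDiffOn_log_deltoidPoly.contDiffAt_of_isOpen isOpen_deltoidDomain hp).differentiableAt_infty
  have h : gaugeFactor k = fun p => Real.exp (k / 2 * Real.log |deltoidPoly p|) := rfl
  rw [h, pd_comp (Real.hasDerivAt_exp _) (hl.const_mul _), pd_mul (by fun_prop) hl, pd_const,
    pd_log_deltoidPoly (ne_of_lt hp)]
  ring

theorem pd_gaugeFactor_mul (k : ℝ) {f : Plane → ℝ} (hf : ContDiffOn ℝ ∞ f deltoidDomain)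
    {p : Plane} (hp : p ∈ deltoidDomain) (i : Fin 2) :
    pd i (fun x => gaugeFactor k x * f x) p = gaugeFactor k p *
      (pd i f p + k / 2 * (pd i deltoidPoly p / deltoidPoly p) * f p) := by
  rw [pd_mul ((contDiffOn_gaugeFactor k).contDiffAt_of_isOpen isOpen_deltoidDomain
    hp).differentiableAt_infty (hf.contDiffAt_of_isOpen isOpen_deltoidDomain
    hp).differentiableAt_infty, pd_gaugeFactor k hp]
  ring

theorem contDiffOn_logDeriv (i : Fin 2) :
    ContDiffOn ℝ ∞ (fun x => pd i deltoidPoly x / deltoidPoly x) deltoidDomain :=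
  (contDiffOn_pd contDiff_deltoidPoly.contDiffOn isOpen_deltoidDomain i).div
    contDiff_deltoidPoly.contDiffOn fun _ hx => ne_of_lt hx

theorem pd_pd_gaugeFactor_mul (k : ℝ) {f : Plane → ℝ} (hf : ContDiffOn ℝ ∞ f deltoidDomain)
    {p : Plane} (hp : p ∈ deltoidDomain) (i j : Fin 2) :
    pd j (pd i (fun x => gaugeFactor k x * f x)) p = gaugeFactor k p *
      (pd j (pd i f) p
        + k / 2 * ((pd j (pd i deltoidPoly) p * deltoidPoly p
            - pd i deltoidPoly p * pd j deltoidPoly p) / deltoidPoly p ^ 2) * f p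
        + k / 2 * (pd i deltoidPoly p / deltoidPoly p) * pd j f p
        + k / 2 * (pd j deltoidPoly p / deltoidPoly p) *
          (pd i f p + k / 2 * (pd i deltoidPoly p / deltoidPoly p) * f p)) := by
  have hD := isOpen_deltoidDomain
  have hs := ((contDiffOn_logDeriv i).contDiffAt_of_isOpen hD hp).differentiableAt_infty
  have hfd := (hf.contDiffAt_of_isOpen hD hp).differentiableAt_infty
  have hfi := ((contDiffOn_pd hf hD i).contDiffAt_of_isOpen hD hp).differentiableAt_infty
  have hsm : ContDiffOn ℝ ∞ (fun x => pd i f x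
      + k / 2 * (pd i deltoidPoly x / deltoidPoly x) * f x) deltoidDomain :=
    (contDiffOn_pd hf hD i).add ((contDiffOn_const.mul (contDiffOn_logDeriv i)).mul hf)
  rw [pd_congr_on hD (fun _ hx => pd_gaugeFactor_mul k hf hx i) hp, pd_gaugeFactor_mul k hsm hp,
    pd_add hfi ((hs.const_mul _).fun_mul hfd), pd_mul (hs.const_mul _) hfd, pd_mul (by fun_prop) hs,
    pd_const, pd_div ((contDiffOn_pd contDiff_deltoidPoly.contDiffOn hD
      i).contDiffAt_of_isOpen hD hp).differentiableAt_infty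
      differentiable_deltoidPoly.differentiableAt (ne_of_lt hp)]
  ring

theorem potentialUV_eq (k : ℝ) (p : Plane) : potentialUV k p = -12 * k ^ 2
    - 12 * k * (1 + k) * ((p 0 - 3) ^ 2 - 3 * p 1 ^ 2) * (2 * p 0 + 3) * (deltoidPoly p)⁻¹ := by
  have h3 : √3 * √3 = (3 : ℝ) := Real.mul_self_sqrt (by norm_num)
  simp only [potentialUV]
  linear_combination (12 * k * (1 + k) * (2 * p 0 + 3) * (deltoidPoly p)⁻¹ * p 1 ^ 2) * h3

theorem contDiffOn_potentialUV (k : ℝ) : ContDiffOn ℝ ∞ (potentialUV k) deltoidDomain := by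
  have h : potentialUV k = fun p => potentialUV k p := rfl
  rw [h]
  simp only [potentialUV_eq]
  have := contDiff_deltoidPoly.contDiffOn.inv (s := deltoidDomain) fun x hx => ne_of_lt hx
  have hN : ContDiff ℝ ∞ fun p : Plane =>
      12 * k * (1 + k) * ((p 0 - 3) ^ 2 - 3 * p 1 ^ 2) * (2 * p 0 + 3) := by fun_prop
  exact contDiffOn_const.sub (hN.contDiffOn.mul this)

theorem pd_pd_deltoidPoly (p : Plane) : pd 0 (pd 0 deltoidPoly) p =
      12 * p 0 ^ 2 + 4 * p 1 ^ 2 - 48 * p 0 + 36 ∧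
    pd 0 (pd 1 deltoidPoly) p = 8 * p 0 * p 1 + 48 * p 1 ∧
    pd 1 (pd 0 deltoidPoly) p = 8 * p 0 * p 1 + 48 * p 1 ∧
    pd 1 (pd 1 deltoidPoly) p = 4 * p 0 ^ 2 + 12 * p 1 ^ 2 + 48 * p 0 + 36 := by
  rw [funext pd_zero_deltoidPoly, funext pd_one_deltoidPoly]
  refine ⟨?_, ?_, ?_, ?_⟩ <;>
  simp (disch := fun_prop) only [pd_add, pd_sub, pd_mul, pd_pow, pd_const, pd_coord] <;>
  simp <;> ring

/-- The zeroth order term of the gauge-transformed operator, which is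
`-(k/2) Δ log|σ| + (k²/4) |∇ log|σ||²`. -/
theorem gauge_potential (k : ℝ) {p : Plane} (hp : deltoidPoly p ≠ 0) :
    -(∑ i, ∑ j, deltoidMetric p i j * (k / 2 * ((pd i (pd j deltoidPoly) p * deltoidPoly p
            - pd j deltoidPoly p * pd i deltoidPoly p) / deltoidPoly p ^ 2)
          + k / 2 * (pd i deltoidPoly p / deltoidPoly p) *
            (k / 2 * (pd j deltoidPoly p / deltoidPoly p))))
      + (4 - 12 * k) * (k / 2) * (p 0 * (pd 0 deltoidPoly p / deltoidPoly p)
        + p 1 * (pd 1 deltoidPoly p / deltoidPoly p)) = potentialUV k p := by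
  obtain ⟨h00, h01, h10, h11⟩ := pd_pd_deltoidPoly p
  have hs : deltoidPoly p = (p 0 ^ 2 + p 1 ^ 2) ^ 2 - 8 * (p 0 ^ 3 - 3 * p 0 * p 1 ^ 2)
    + 18 * (p 0 ^ 2 + p 1 ^ 2) - 27 := rfl
  simp only [Fin.sum_univ_two, potentialUV_eq, h00, h01, h10, h11, pd_zero_deltoidPoly,
    pd_one_deltoidPoly]
  simp [deltoidMetric]
  field_simp
  rw [hs]
  ring

theorem gauge_hamiltonianZero (k : ℝ) {f : Plane → ℝ} (hf : ContDiffOn ℝ ∞ f deltoidDomain)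
    {p : Plane} (hp : p ∈ deltoidDomain) :
    (gaugeFactor k p)⁻¹ * hamiltonianZero k (fun x => gaugeFactor k x * f x) p
      = schrodinger deltoidMetric (potentialUV k) f p := by
  have hp0 : deltoidPoly p ≠ 0 := ne_of_lt hp
  have h0 := deltoidMetric_grad_deltoidPoly p 0
  have h1 := deltoidMetric_grad_deltoidPoly p 1
  have hsym : deltoidMetric p 1 0 = deltoidMetric p 0 1 := rfl
  have hg : (gaugeFactor k p)⁻¹ * gaugeFactor k p = 1 :=
    inv_mul_cancel₀ (gaugeFactor_pos k p).ne'
  simp only [Fin.sum_univ_two, hsym] at h0 h1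
  rw [schrodinger, ← gauge_potential k hp0, laplaceBeltrami_deltoid hp0, hamiltonianZero_eq k hp0]
  simp only [pd_pd_gaugeFactor_mul k hf hp, pd_gaugeFactor_mul k hf hp, Fin.sum_univ_two, hsym]
  generalize gaugeFactor k p = μ at *
  -- after division by `σ`, the relation `g ∇σ = -12 σ (u, v)` controls the cross terms
  have h0' : deltoidMetric p 0 0 * (pd 0 deltoidPoly p / deltoidPoly p)
      + deltoidMetric p 0 1 * (pd 1 deltoidPoly p / deltoidPoly p) = -12 * p 0 := by
    field_simp; linear_combination h0
  have h1' : deltoidMetric p 0 1 * (pd 0 deltoidPoly p / deltoidPoly p)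
      + deltoidMetric p 1 1 * (pd 1 deltoidPoly p / deltoidPoly p) = -12 * p 1 := by
    field_simp; linear_combination h1
  generalize pd 0 deltoidPoly p / deltoidPoly p = s0 at *
  generalize pd 1 deltoidPoly p / deltoidPoly p = s1 at *
  have e : ∀ x : ℝ, μ⁻¹ * (μ * x) = x := fun x => by rw [← mul_assoc, hg, one_mul]
  refine Eq.trans ?_ (e _)
  congr 1
  linear_combination (-k * μ * pd 0 f p) * h0' + (-k * μ * pd 1 f p) * h1'

theorem FirstOrderOp.apply_congr {D : Set Plane} (hD : IsOpen D) (T : FirstOrderOp)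
    {f h : Plane → ℝ} (hfh : ∀ x ∈ D, f x = h x) {p : Plane} (hp : p ∈ D) :
    T.apply f p = T.apply h p := by
  simp only [FirstOrderOp.apply, hfh p hp, pd_congr_on hD hfh hp]

/-- The gauge transform `T.gauge μ` is the conjugate `μ⁻¹ ∘ T ∘ μ`. -/
theorem FirstOrderOp.gauge_apply (T : FirstOrderOp) {μ f : Plane → ℝ} {p : Plane}
    (hμ : DifferentiableAt ℝ μ p) (hf : DifferentiableAt ℝ f p) (h0 : μ p ≠ 0) :
    (T.gauge μ).apply f p = (μ p)⁻¹ * T.apply (fun x => μ x * f x) p := by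
  simp only [FirstOrderOp.apply, FirstOrderOp.gauge, Fin.sum_univ_two, pd_mul hμ hf]
  field_simp
  ring

theorem FirstOrderOp.contDiffOn_apply {D : Set Plane} (hD : IsOpen D) {T : FirstOrderOp}
    (hv : ∀ i, ContDiffOn ℝ ∞ (T.vec i) D) (hfn : ContDiffOn ℝ ∞ T.fn D) {f : Plane → ℝ}
    (hf : ContDiffOn ℝ ∞ f D) : ContDiffOn ℝ ∞ (T.apply f) D := by
  have h : T.apply f = fun p => ∑ i, T.vec i p * pd i f p + T.fn p * f p := rfl
  rw [h]
  exact (ContDiffOn.sum fun i _ => (hv i).mul (contDiffOn_pd hf hD i)).add (hfn.mul hf)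

section
variable {D : Set Plane} {μ : Plane → ℝ} {n : ℕ} {T : Fin n → FirstOrderOp} {f : Plane → ℝ}

theorem gauge_apply_of_mem (S : FirstOrderOp) (hD : IsOpen D) (hμ : ContDiffOn ℝ ∞ μ D)
    (h0 : ∀ p ∈ D, μ p ≠ 0) (hf : ContDiffOn ℝ ∞ f D) {p : Plane} (hp : p ∈ D) :
    (S.gauge μ).apply f p = (μ p)⁻¹ * S.apply (fun x => μ x * f x) p :=
  S.gauge_apply (hμ.contDiffAt_of_isOpen hD hp).differentiableAt_infty
    (hf.contDiffAt_of_isOpen hD hp).differentiableAt_infty (h0 p hp)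

theorem contDiffOn_gauge (hD : IsOpen D) (hμ : ContDiffOn ℝ ∞ μ D) (h0 : ∀ p ∈ D, μ p ≠ 0)
    {S : FirstOrderOp} (hv : ∀ i, ContDiffOn ℝ ∞ (S.vec i) D) (hfn : ContDiffOn ℝ ∞ S.fn D) :
    (∀ i, ContDiffOn ℝ ∞ ((S.gauge μ).vec i) D) ∧ ContDiffOn ℝ ∞ (S.gauge μ).fn D :=
  ⟨hv, hfn.add ((ContDiffOn.sum fun i _ => (hv i).mul (contDiffOn_pd hμ hD i)).div hμ h0)⟩

theorem gauge_apply_apply_of_mem {S S' : FirstOrderOp} (hD : IsOpen D)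
    (hμ : ContDiffOn ℝ ∞ μ D) (h0 : ∀ p ∈ D, μ p ≠ 0)
    (hv : ∀ i, ContDiffOn ℝ ∞ (S'.vec i) D) (hfn : ContDiffOn ℝ ∞ S'.fn D)
    (hf : ContDiffOn ℝ ∞ f D) {p : Plane} (hp : p ∈ D) :
    (S.gauge μ).apply ((S'.gauge μ).apply f) p
      = (μ p)⁻¹ * S.apply (S'.apply (fun x => μ x * f x)) p := by
  have hg := contDiffOn_gauge hD hμ h0 hv hfn
  rw [gauge_apply_of_mem S hD hμ h0 (FirstOrderOp.contDiffOn_apply hD hg.1 hg.2 hf) hp]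
  congr 1
  refine FirstOrderOp.apply_congr hD S (fun x hx => ?_) hp
  rw [gauge_apply_of_mem S' hD hμ h0 hf hx, mul_inv_cancel_left₀ (h0 x hx)]

theorem GeneratesLieAlgebra.gauge (hD : IsOpen D) (hμ : ContDiffOn ℝ ∞ μ D)
    (h0 : ∀ p ∈ D, μ p ≠ 0) (hT : GeneratesLieAlgebra D T) :
    GeneratesLieAlgebra D (fun a => (T a).gauge μ) := by
  obtain ⟨hsm, c, hc⟩ := hT
  refine ⟨fun a => contDiffOn_gauge hD hμ h0 (hsm a).1 (hsm a).2, c, fun a b f hf p hp => ?_⟩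
  have := hc a b (fun x => μ x * f x) (hμ.mul hf) p hp
  simp only [gauge_apply_apply_of_mem hD hμ h0 (hsm _).1 (hsm _).2 hf hp,
    gauge_apply_of_mem _ hD hμ h0 hf hp, ← mul_sub, this, Finset.mul_sum]
  exact Finset.sum_congr rfl fun d _ => by ring

/-- Conjugation by a nowhere vanishing function preserves Lie-algebraic form. -/
theorem IsLieAlgebraicOver.gauge {H K : (Plane → ℝ) → Plane → ℝ} (hD : IsOpen D)
    (hμ : ContDiffOn ℝ ∞ μ D) (h0 : ∀ p ∈ D, μ p ≠ 0) (hH : IsLieAlgebraicOver D T H)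
    (hK : ∀ f : Plane → ℝ, ContDiffOn ℝ ∞ f D → ∀ p ∈ D,
      (μ p)⁻¹ * H (fun x => μ x * f x) p = K f p) :
    IsLieAlgebraicOver D (fun a => (T a).gauge μ) K := by
  obtain ⟨hT, C, B, hC, h⟩ := hH
  refine ⟨hT.gauge hD hμ h0, C, B, hC, fun f hf p hp => ?_⟩
  have hsm := hT.1
  rw [← hK f hf p hp, h _ (hμ.mul hf) p hp]
  simp only [gauge_apply_apply_of_mem hD hμ h0 (hsm _).1 (hsm _).2 hf hp,
    gauge_apply_of_mem _ hD hμ h0 hf hp, mul_add, Finset.mul_sum]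
  congr 1
  · exact Finset.sum_congr rfl fun a _ => Finset.sum_congr rfl fun b _ => by ring
  · exact Finset.sum_congr rfl fun a _ => by ring

end

theorem isLieAlgebraicOver_schrodinger (k : ℝ) :
    IsLieAlgebraicOver deltoidDomain (fun a => (affineGenerators a).gauge (gaugeFactor k))
      (schrodinger deltoidMetric (potentialUV k)) :=
  (isLieAlgebraicOver_hamiltonianZero k).gauge isOpen_deltoidDomain (contDiffOn_gaugeFactor k)
    (fun p _ => (gaugeFactor_pos k p).ne') fun _ hf _ hp => gauge_hamiltonianZero k hf hp

/-! ### The character map -/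

theorem characterMap_zero (L : Plane) : characterMap L 0 = Real.cos (2 * Real.pi * L 0)
    + Real.cos (2 * Real.pi * L 1) + Real.cos (2 * Real.pi * L 0 + 2 * Real.pi * L 1) := by
  have h : ∀ x : ℝ, 2 * (Real.pi : ℂ) * Complex.I * (x : ℂ)
      = ((2 * Real.pi * x : ℝ) : ℂ) * Complex.I := fun x => by push_cast; ring
  simp only [characterMap, h, Matrix.cons_val_zero, Complex.add_re, Complex.exp_ofReal_mul_I_re]
  have e : 2 * Real.pi * (-L 0 - L 1) = -(2 * Real.pi * L 0 + 2 * Real.pi * L 1) := by ring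
  rw [e, Real.cos_neg]

theorem characterMap_one (L : Plane) : characterMap L 1 = Real.sin (2 * Real.pi * L 0)
    + Real.sin (2 * Real.pi * L 1) - Real.sin (2 * Real.pi * L 0 + 2 * Real.pi * L 1) := by
  have h : ∀ x : ℝ, 2 * (Real.pi : ℂ) * Complex.I * (x : ℂ)
      = ((2 * Real.pi * x : ℝ) : ℂ) * Complex.I := fun x => by push_cast; ring
  simp only [characterMap, h, Matrix.cons_val_one, Matrix.cons_val_fin_one, Complex.add_im,
    Complex.exp_ofReal_mul_I_im]
  have e : 2 * Real.pi * (-L 0 - L 1) = -(2 * Real.pi * L 0 + 2 * Real.pi * L 1) := by ring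
  rw [e, Real.sin_neg, ← sub_eq_add_neg]

theorem contDiff_characterMap_apply (a : Fin 2) : ContDiff ℝ ∞ fun L => characterMap L a := by
  fin_cases a
  · simp only [Fin.zero_eta, characterMap_zero]; fun_prop
  · simp only [Fin.mk_one, characterMap_one]; fun_prop

theorem contDiff_characterMap : ContDiff ℝ ∞ characterMap :=
  contDiff_pi.2 contDiff_characterMap_apply

/-- In terms of `a = π (L₁ + L₂)`, `b = π (L₁ - L₂)` the character is `2 cos b e^{ia} + e^{-2ia}`. -/
theorem characterMap_half (L : Plane) :
    characterMap L 0 = 2 * Real.cos (Real.pi * L 0 + Real.pi * L 1)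
        * Real.cos (Real.pi * L 0 - Real.pi * L 1)
        + 2 * Real.cos (Real.pi * L 0 + Real.pi * L 1) ^ 2 - 1 ∧
    characterMap L 1 = 2 * Real.sin (Real.pi * L 0 + Real.pi * L 1) *
      (Real.cos (Real.pi * L 0 - Real.pi * L 1) - Real.cos (Real.pi * L 0 + Real.pi * L 1)) := by
  rw [characterMap_zero, characterMap_one]
  set a := Real.pi * L 0 + Real.pi * L 1 with ha
  set b := Real.pi * L 0 - Real.pi * L 1 with hb
  have h0 : 2 * Real.pi * L 0 = a + b := by rw [ha, hb]; ring
  have h1 : 2 * Real.pi * L 1 = a - b := by rw [ha, hb]; ring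
  rw [h0, h1]
  clear_value a b
  have h2 : a + b + (a - b) = 2 * a := by ring
  rw [h2, Real.cos_two_mul, Real.sin_two_mul, Real.cos_add, Real.cos_sub, Real.sin_add,
    Real.sin_sub]
  constructor <;> ring

/-- The deltoid polynomial at the point `2x e^{ia} + e^{-2ia}`. -/
theorem deltoidPoly_factor {p : Plane} {c s x : ℝ} (hcs : s ^ 2 = 1 - c ^ 2)
    (hu : p 0 = 2 * c * x + 2 * c ^ 2 - 1) (hv : p 1 = 2 * s * (x - c)) :
    deltoidPoly p = 16 * (x ^ 2 - 1) * (x - (4 * c ^ 3 - 3 * c)) ^ 2 := by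
  have hv2 : p 1 ^ 2 = 4 * (1 - c ^ 2) * (x - c) ^ 2 := by rw [hv, ← hcs]; ring
  simp only [deltoidPoly, hv2, hu]
  ring

theorem sin_mul_sin_mirror (L : Plane) :
    Real.sin (2 * Real.pi * L 0 + Real.pi * L 1) * Real.sin (Real.pi * L 0 + 2 * Real.pi * L 1)
      = (Real.cos (Real.pi * L 0 - Real.pi * L 1)
        - Real.cos (3 * (Real.pi * L 0 + Real.pi * L 1))) / 2 := by
  set A := 2 * Real.pi * L 0 + Real.pi * L 1 with hA
  set B := Real.pi * L 0 + 2 * Real.pi * L 1 with hB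
  have h1 : Real.pi * L 0 - Real.pi * L 1 = A - B := by rw [hA, hB]; ring
  have h2 : 3 * (Real.pi * L 0 + Real.pi * L 1) = A + B := by rw [hA, hB]; ring
  rw [h1, h2, Real.cos_add, Real.cos_sub]
  ring

theorem sin_sq_add_sin_sq_mirror (L : Plane) :
    Real.sin (2 * Real.pi * L 0 + Real.pi * L 1) ^ 2
        + Real.sin (Real.pi * L 0 + 2 * Real.pi * L 1) ^ 2
      = 1 - Real.cos (Real.pi * L 0 - Real.pi * L 1)
        * Real.cos (3 * (Real.pi * L 0 + Real.pi * L 1)) := by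
  set A := 2 * Real.pi * L 0 + Real.pi * L 1 with hA
  set B := Real.pi * L 0 + 2 * Real.pi * L 1 with hB
  have h1 : Real.pi * L 0 - Real.pi * L 1 = A - B := by rw [hA, hB]; ring
  have h2 : 3 * (Real.pi * L 0 + Real.pi * L 1) = A + B := by rw [hA, hB]; ring
  rw [h1, h2, Real.cos_add, Real.cos_sub]
  have e1 := Real.sin_sq_add_cos_sq A
  have e2 := Real.sin_sq_add_cos_sq B
  linear_combination (Real.cos B ^ 2) * e1 + (1 - Real.sin A ^ 2) * e2

theorem deltoidPoly_characterMap (L : Plane) : deltoidPoly (characterMap L) =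
    -64 * (Real.sin (Real.pi * L 0 - Real.pi * L 1)
      * (Real.sin (2 * Real.pi * L 0 + Real.pi * L 1)
        * Real.sin (Real.pi * L 0 + 2 * Real.pi * L 1))) ^ 2 := by
  obtain ⟨hu, hv⟩ := characterMap_half L
  rw [deltoidPoly_factor (Real.sin_sq _) hu hv, sin_mul_sin_mirror, Real.cos_three_mul, mul_pow,
    Real.sin_sq]
  ring

theorem characterMap_mem {L : Plane} (hL : L ∈ mirrorComplement) :
    characterMap L ∈ deltoidDomain := by
  have h : Real.sin (Real.pi * L 0 - Real.pi * L 1)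
      * (Real.sin (2 * Real.pi * L 0 + Real.pi * L 1)
        * Real.sin (Real.pi * L 0 + 2 * Real.pi * L 1)) ≠ 0 :=
    mul_ne_zero hL.1 (mul_ne_zero hL.2.1 hL.2.2)
  have : deltoidPoly (characterMap L) < 0 := by
    rw [deltoidPoly_characterMap]
    have := sq_pos_of_ne_zero h
    linarith
  exact this

/-- The rotated point `(u + iv) e^{-ia} - e^{-3ia}` is real for some angle `a`, by the
intermediate value theorem; this exhibits `u + iv` as `2x e^{ia} + e^{-2ia}` with `x` real. -/
theorem exists_angle (p : Plane) : ∃ a x : ℝ,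
    p 0 = 2 * Real.cos a * x + 2 * Real.cos a ^ 2 - 1 ∧
    p 1 = 2 * Real.sin a * (x - Real.cos a) := by
  let F : ℝ → ℝ := fun a => p 1 * Real.cos a - p 0 * Real.sin a + Real.sin (3 * a)
  have hF : Continuous F := by fun_prop
  have hpi : F Real.pi = -F 0 := by
    have h3 : Real.sin (3 * Real.pi) = 0 := by
      rw [Real.sin_three_mul, Real.sin_pi]; ring
    simp [F, h3]
  obtain ⟨a, ha⟩ : ∃ a, F a = 0 := by
    rcases le_total (F 0) 0 with h | h
    · exact mem_range_of_exists_le_of_exists_ge hF ⟨0, h⟩ ⟨Real.pi, by rw [hpi]; linarith⟩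
    · exact mem_range_of_exists_le_of_exists_ge hF ⟨Real.pi, by rw [hpi]; linarith⟩ ⟨0, h⟩
  have hcs := Real.sin_sq_add_cos_sq a
  have ha' : p 1 * Real.cos a - p 0 * Real.sin a + (3 * Real.sin a - 4 * Real.sin a ^ 3) = 0 := by
    rw [← Real.sin_three_mul]; exact ha
  refine ⟨a, (p 0 * Real.cos a + p 1 * Real.sin a - (4 * Real.cos a ^ 3 - 3 * Real.cos a)) / 2,
    ?_, ?_⟩
  · generalize Real.cos a = c at *
    generalize Real.sin a = s at *
    linear_combination (-s) * ha' + (-p 0 + 4 * c ^ 2 - 4 * s ^ 2 - 1) * hcs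
  · generalize Real.cos a = c at *
    generalize Real.sin a = s at *
    linear_combination c * ha' + (-p 1 + 4 * s * c) * hcs

theorem characterMap_image : characterMap '' mirrorComplement = deltoidDomain := by
  refine Set.Subset.antisymm (by rintro _ ⟨L, hL, rfl⟩; exact characterMap_mem hL) ?_
  intro p hp
  obtain ⟨a, x, hu, hv⟩ := exists_angle p
  have hfac := deltoidPoly_factor (Real.sin_sq a) hu hv
  have hneg : deltoidPoly p < 0 := hp
  have hx : x ^ 2 < 1 := by
    by_contra h
    push Not at h
    have : 0 ≤ x ^ 2 - 1 := by linarith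
    rw [hfac] at hneg
    have : 0 ≤ 16 * (x ^ 2 - 1) * (x - (4 * Real.cos a ^ 3 - 3 * Real.cos a)) ^ 2 := by positivity
    linarith
  obtain ⟨hx1, hx2⟩ := abs_lt.1 ((sq_lt_one_iff_abs_lt_one x).1 hx)
  have hpi := Real.pi_ne_zero
  let L : Plane := ![(a + Real.arccos x) / (2 * Real.pi), (a - Real.arccos x) / (2 * Real.pi)]
  have e1 : Real.pi * L 0 + Real.pi * L 1 = a := by simp [L]; field_simp; ring
  have e2 : Real.pi * L 0 - Real.pi * L 1 = Real.arccos x := by simp [L]; field_simp; ring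
  have hL : characterMap L = p := by
    obtain ⟨h0, h1⟩ := characterMap_half L
    rw [e1, e2, Real.cos_arccos hx1.le hx2.le] at h0 h1
    ext i
    fin_cases i
    · exact h0.trans hu.symm
    · exact h1.trans hv.symm
  refine ⟨L, ?_, hL⟩
  have hne : deltoidPoly (characterMap L) ≠ 0 := by rw [hL]; exact hneg.ne
  rw [deltoidPoly_characterMap] at hne
  refine ⟨fun h => hne ?_, fun h => hne ?_, fun h => hne ?_⟩ <;> rw [h] <;> ring

theorem potentialUV_characterMap (k : ℝ) {L : Plane} (hL : L ∈ mirrorComplement) :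
    potentialUV k (characterMap L) = potentialL k L := by
  obtain ⟨hu, hv⟩ := characterMap_half L
  have hsum := sin_sq_add_sin_sq_mirror L
  have hprod := sin_mul_sin_mirror L
  obtain ⟨hs1, hs2, hs3⟩ := hL
  have hfac := deltoidPoly_characterMap L
  rw [potentialUV_eq, hfac, potentialL]
  have hcs := Real.sin_sq (Real.pi * L 0 + Real.pi * L 1)
  have hxs := Real.sin_sq (Real.pi * L 0 - Real.pi * L 1)
  rw [Real.cos_three_mul] at hsum hprod
  generalize Real.sin (2 * Real.pi * L 0 + Real.pi * L 1) = A at *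
  generalize Real.sin (Real.pi * L 0 + 2 * Real.pi * L 1) = B at *
  generalize Real.sin (Real.pi * L 0 - Real.pi * L 1) = S at *
  generalize Real.cos (Real.pi * L 0 - Real.pi * L 1) = x at *
  generalize Real.sin (Real.pi * L 0 + Real.pi * L 1) = s at *
  generalize Real.cos (Real.pi * L 0 + Real.pi * L 1) = c at *
  have hv2 : characterMap L 1 ^ 2 = 4 * (1 - c ^ 2) * (x - c) ^ 2 := by rw [hv, ← hcs]; ring
  have hT : ((characterMap L 0 - 3) ^ 2 - 3 * characterMap L 1 ^ 2) * (2 * characterMap L 0 + 3)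
      = 16 * (A ^ 2 * B ^ 2 + (A ^ 2 + B ^ 2) * S ^ 2) := by
    rw [hv2, hu, hsum, hxs, ← mul_pow, hprod]; ring
  rw [mul_assoc (12 * k * (1 + k)), hT]
  field_simp
  ring

theorem pd_characterMap (L : Plane) :
    pd 0 (fun x => characterMap x 0) L = -(2 * Real.pi) * (Real.sin (2 * Real.pi * L 0)
      + Real.sin (2 * Real.pi * L 0 + 2 * Real.pi * L 1)) ∧
    pd 1 (fun x => characterMap x 0) L = -(2 * Real.pi) * (Real.sin (2 * Real.pi * L 1)
      + Real.sin (2 * Real.pi * L 0 + 2 * Real.pi * L 1)) ∧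
    pd 0 (fun x => characterMap x 1) L = 2 * Real.pi * (Real.cos (2 * Real.pi * L 0)
      - Real.cos (2 * Real.pi * L 0 + 2 * Real.pi * L 1)) ∧
    pd 1 (fun x => characterMap x 1) L = 2 * Real.pi * (Real.cos (2 * Real.pi * L 1)
      - Real.cos (2 * Real.pi * L 0 + 2 * Real.pi * L 1)) := by
  have hsin : ∀ (f : Plane → ℝ), DifferentiableAt ℝ f L → ∀ i,
      pd i (fun x => Real.sin (f x)) L = Real.cos (f L) * pd i f L :=
    fun f hf i => pd_comp (Real.hasDerivAt_sin _) hf i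
  have hcos : ∀ (f : Plane → ℝ), DifferentiableAt ℝ f L → ∀ i,
      pd i (fun x => Real.cos (f x)) L = -Real.sin (f L) * pd i f L :=
    fun f hf i => pd_comp (Real.hasDerivAt_cos _) hf i
  simp only [characterMap_zero, characterMap_one]
  refine ⟨?_, ?_, ?_, ?_⟩ <;>
  simp (disch := fun_prop) only [pd_add, pd_sub, hsin, hcos, pd_mul, pd_const, pd_coord] <;>
  simp <;> ring

theorem characterMap_isometry (L : Plane) (a b : Fin 2) :
    (∑ i, ∑ j, weightMetric i j * pd i (fun x => characterMap x a) L
      * pd j (fun x => characterMap x b) L) = deltoidMetric (characterMap L) a b := by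
  obtain ⟨h00, h10, h01, h11⟩ := pd_characterMap L
  have hpi := Real.pi_ne_zero
  have s1 := Real.sin_sq (2 * Real.pi * L 0)
  have s2 := Real.sin_sq (2 * Real.pi * L 1)
  fin_cases a <;> fin_cases b <;>
    simp only [Fin.zero_eta, Fin.mk_one, Fin.sum_univ_two, h00, h10, h01, h11] <;>
    simp [weightMetric, deltoidMetric, characterMap_zero, characterMap_one, Real.sin_add,
      Real.cos_add] <;>
    generalize Real.sin (2 * Real.pi * L 0) = S1 at * <;>
    generalize Real.cos (2 * Real.pi * L 0) = C1 at * <;>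
    generalize Real.sin (2 * Real.pi * L 1) = S2 at * <;>
    generalize Real.cos (2 * Real.pi * L 1) = C2 at * <;>
    field_simp <;> ring_nf <;> simp only [s1, s2] <;> ring_nf

/-- The components of the character map are eigenfunctions of the flat Laplacian. -/
theorem laplacian_characterMap (L : Plane) (a : Fin 2) :
    (∑ i, ∑ j, weightMetric i j * pd i (pd j (fun x => characterMap x a)) L)
      = -4 * characterMap L a := by
  have hpi := Real.pi_ne_zero
  have hsin : ∀ (f : Plane → ℝ), DifferentiableAt ℝ f L → ∀ i,
      pd i (fun x => Real.sin (f x)) L = Real.cos (f L) * pd i f L :=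
    fun f hf i => pd_comp (Real.hasDerivAt_sin _) hf i
  have hcos : ∀ (f : Plane → ℝ), DifferentiableAt ℝ f L → ∀ i,
      pd i (fun x => Real.cos (f x)) L = -Real.sin (f L) * pd i f L :=
    fun f hf i => pd_comp (Real.hasDerivAt_cos _) hf i
  fin_cases a <;>
  simp only [Fin.zero_eta, Fin.mk_one, Fin.sum_univ_two, funext fun x => (pd_characterMap x).1,
    funext fun x => (pd_characterMap x).2.1, funext fun x => (pd_characterMap x).2.2.1,
    funext fun x => (pd_characterMap x).2.2.2] <;>
  simp (disch := fun_prop) only [pd_add, pd_sub, hsin, hcos, pd_mul, pd_const, pd_coord] <;>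
  simp [weightMetric, characterMap_zero, characterMap_one] <;> field_simp <;> ring

/-! ### Liouville coordinates and the trigonometric potential -/

/-- The covectors `n_j`, as complex numbers: the mirrors are the lines `Re (n_j z) ∈ πℤ`. -/
noncomputable def mirrorNormal : Fin 3 → ℂ :=
  ![1, (1 - √3 * Complex.I) / 2, (1 + √3 * Complex.I) / 2]

/-- The potential as a function of an isotropic coordinate `z` of the flat plane. -/
noncomputable def potentialZ (k : ℝ) (z : ℂ) : ℝ :=
  -12 * k ^ 2 + 3 * k * (1 + k) * ∑ j, 1 / Real.sin ((mirrorNormal j * z).re) ^ 2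

theorem HasDerivAt.re_comp {f : ℝ → ℂ} {f' : ℂ} {t : ℝ} (h : HasDerivAt f f' t) :
    HasDerivAt (fun t => (f t).re) f'.re t :=
  Complex.reCLM.hasFDerivAt.comp_hasDerivAt t h

theorem HasDerivAt.im_comp {f : ℝ → ℂ} {f' : ℂ} {t : ℝ} (h : HasDerivAt f f' t) :
    HasDerivAt (fun t => (f t).im) f'.im t :=
  Complex.imCLM.hasFDerivAt.comp_hasDerivAt t h

/-- The derivative of a holomorphic function in the direction `d`. -/
theorem HasDerivAt.comp_line {Z : ℂ → ℂ} {Z' w : ℂ} (h : HasDerivAt Z Z' w) (d : ℂ) :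
    HasDerivAt (fun t : ℝ => Z (w + t * d)) (d * Z') 0 := by
  have h1 : HasDerivAt (fun t : ℝ => w + (t : ℂ) * d) d 0 := by
    simpa using ((Complex.ofRealCLM.hasDerivAt (x := 0)).mul_const d).const_add w
  have h2 : HasDerivAt Z Z' (w + ((0 : ℝ) : ℂ) * d) := by simpa using h
  have := h2.scomp (0 : ℝ) h1
  simpa [Function.comp_def] using this

theorem eventually_line_mem {O : Set ℂ} (hO : IsOpen O) {w : ℂ} (hw : w ∈ O) (d : ℂ) :
    ∀ᶠ t : ℝ in 𝓝 0, w + t * d ∈ O := by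
  have hc : Continuous fun t : ℝ => w + (t : ℂ) * d := by fun_prop
  have : Filter.Tendsto (fun t : ℝ => w + (t : ℂ) * d) (𝓝 0) (𝓝 w) := by
    simpa using hc.tendsto 0
  exact this (hO.mem_nhds hw)

/-- A sum of a function of `Re w` and a function of `Im w` has vanishing mixed derivative; no
regularity of the two summands is assumed. -/
theorem mixed_deriv_eq_zero {O : Set ℂ} (hO : IsOpen O) {Φ Φ' : ℂ → ℝ} {h₀ h₁ : ℝ → ℝ}
    (hΦ : ∀ w ∈ O, Φ w = h₀ w.re + h₁ w.im)
    (hΦ' : ∀ w ∈ O, HasDerivAt (fun t : ℝ => Φ (w + t * Complex.I)) (Φ' w) 0)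
    {w₀ : ℂ} (hw₀ : w₀ ∈ O) {d : ℝ} (hd : HasDerivAt (fun t : ℝ => Φ' (w₀ + t * 1)) d 0) :
    d = 0 := by
  have key : ∀ w ∈ O, Φ' w = deriv (fun t => h₀ 0 + h₁ (w.im + t)) 0 := by
    intro w hw
    have h2 := (hΦ' w hw).sub_const (h₀ w.re - h₀ 0)
    refine (h2.congr_of_eventuallyEq ?_).deriv.symm
    filter_upwards [eventually_line_mem hO hw Complex.I] with t ht
    rw [hΦ _ ht]
    simp [add_comm]
  have hconst : (fun t : ℝ => Φ' (w₀ + t * 1))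
      =ᶠ[𝓝 0] fun _ => deriv (fun t => h₀ 0 + h₁ (w₀.im + t)) 0 := by
    filter_upwards [eventually_line_mem hO hw₀ 1] with t ht
    rw [key _ ht]
    simp
  exact hd.unique ((hasDerivAt_const (0 : ℝ) _).congr_of_eventuallyEq hconst)

/-- A holomorphic function with real values is constant. -/
theorem exists_const_of_im_eq_zero {B : Set ℂ} (hB : IsOpen B) (hB' : IsPreconnected B)
    {g : ℂ → ℂ} (hg : DifferentiableOn ℂ g B) (him : ∀ w ∈ B, (g w).im = 0) :
    ∃ c : ℝ, ∀ w ∈ B, g w = c := by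
  have hd : Set.EqOn (deriv g) 0 B := by
    intro w hw
    have hgw := (hg.differentiableAt (hB.mem_nhds hw)).hasDerivAt
    have key : ∀ d : ℂ, (d * deriv g w).im = 0 := by
      intro d
      refine ((hgw.comp_line d).im_comp).unique ?_
      refine (hasDerivAt_const (0 : ℝ) (0 : ℝ)).congr_of_eventuallyEq ?_
      filter_upwards [eventually_line_mem hB hw d] with t ht
      exact him _ ht
    have h1 := key 1
    have h2 := key Complex.I
    simp at h1 h2
    exact Complex.ext h2 h1
  obtain ⟨a, ha⟩ := hB.exists_is_const_of_deriv_eq_zero hB' hg hd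
  rcases B.eq_empty_or_nonempty with rfl | ⟨w, hw⟩
  · exact ⟨0, fun w hw => hw.elim⟩
  · refine ⟨a.re, fun x hx => ?_⟩
    rw [ha x hx]
    have := him w hw
    rw [ha w hw] at this
    exact Complex.ext (by simp) (by simp [this])

/-- The part of the Bertrand-Darboux equation contributed by one mirror family, after
multiplication by `sin⁴ (Re (n z))`; `A` and `C` stand for `Im (n² P)` and `Im (n P'/2)`. -/
noncomputable def darbouxTerm (A C θ : ℝ) : ℝ :=
  A * (3 - 2 * Real.sin θ ^ 2) - 6 * C * Real.cos θ * Real.sin θ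

/-- The Bertrand-Darboux equation for `∑ 1 / sin² (Re (n_j z))` and a quadratic polynomial
`P(z) = c z² + 2 β z + γ`, with `c` real, has only the trivial solution `P = 0`: clearing
denominators and continuing analytically, `Im (n_j² P)` must vanish on all mirrors `Re (n_j z) ∈ πℤ`.
-/
theorem darboux_trivial {U : Set ℂ} (hU : IsOpen U) (hU' : U.Nonempty) {c : ℝ} {β γ : ℂ}
    (hsin : ∀ z ∈ U, ∀ j, Real.sin ((mirrorNormal j * z).re) ≠ 0)
    (hBD : ∀ z ∈ U, ∑ j, darbouxTerm ((mirrorNormal j ^ 2 * (c * z ^ 2 + 2 * β * z + γ)).im)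
      ((mirrorNormal j * (c * z + β)).im) ((mirrorNormal j * z).re)
        / Real.sin ((mirrorNormal j * z).re) ^ 4 = 0) :
    ∀ z : ℂ, c * z ^ 2 + 2 * β * z + γ = 0 := by
  let θ : Fin 3 → ℂ → ℝ := fun j z => (mirrorNormal j * z).re
  let A : Fin 3 → ℂ → ℝ := fun j z => (mirrorNormal j ^ 2 * (c * z ^ 2 + 2 * β * z + γ)).im
  let C : Fin 3 → ℂ → ℝ := fun j z => (mirrorNormal j * (c * z + β)).im
  let G : ℂ → ℝ := fun z =>
    Real.sin (θ 1 z) ^ 4 * Real.sin (θ 2 z) ^ 4 * darbouxTerm (A 0 z) (C 0 z) (θ 0 z)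
    + Real.sin (θ 0 z) ^ 4 * Real.sin (θ 2 z) ^ 4 * darbouxTerm (A 1 z) (C 1 z) (θ 1 z)
    + Real.sin (θ 0 z) ^ 4 * Real.sin (θ 1 z) ^ 4 * darbouxTerm (A 2 z) (C 2 z) (θ 2 z)
  have hre : ∀ {f : ℂ → ℂ}, AnalyticOnNhd ℝ f Set.univ →
      AnalyticOnNhd ℝ (fun z => (f z).re) Set.univ :=
    fun hf z hz => (Complex.reCLM.analyticAt _).comp (hf z hz)
  have him : ∀ {f : ℂ → ℂ}, AnalyticOnNhd ℝ f Set.univ →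
      AnalyticOnNhd ℝ (fun z => (f z).im) Set.univ :=
    fun hf z hz => (Complex.imCLM.analyticAt _).comp (hf z hz)
  have hid : AnalyticOnNhd ℝ (fun z : ℂ => z) Set.univ := analyticOnNhd_id
  have hcst : ∀ a : ℂ, AnalyticOnNhd ℝ (fun _ : ℂ => a) Set.univ := fun a => analyticOnNhd_const
  have hθ : ∀ j, AnalyticOnNhd ℝ (θ j) Set.univ := fun j => hre ((hcst _).mul hid)
  have hA : ∀ j, AnalyticOnNhd ℝ (A j) Set.univ := fun j =>
    him ((hcst _).mul ((((hcst _).mul (hid.pow 2)).add ((hcst _).mul hid)).add (hcst _)))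
  have hC : ∀ j, AnalyticOnNhd ℝ (C j) Set.univ := fun j =>
    him ((hcst _).mul (((hcst _).mul hid).add (hcst _)))
  have hsinA : ∀ j, AnalyticOnNhd ℝ (fun z => Real.sin (θ j z)) Set.univ :=
    fun j z hz => (Real.analyticAt_sin).comp (hθ j z hz)
  have hcosA : ∀ j, AnalyticOnNhd ℝ (fun z => Real.cos (θ j z)) Set.univ :=
    fun j z hz => (Real.analyticAt_cos).comp (hθ j z hz)
  have hcr : ∀ a : ℝ, AnalyticOnNhd ℝ (fun _ : ℂ => a) Set.univ := fun a => analyticOnNhd_const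
  have hterm : ∀ j, AnalyticOnNhd ℝ (fun z => darbouxTerm (A j z) (C j z) (θ j z)) Set.univ :=
    fun j => ((hA j).mul ((hcr 3).sub ((hcr 2).mul ((hsinA j).pow 2)))).sub
      ((((hcr 6).mul (hC j)).mul (hcosA j)).mul (hsinA j))
  have hG : AnalyticOnNhd ℝ G Set.univ :=
    (((((hsinA 1).pow 4).mul ((hsinA 2).pow 4)).mul (hterm 0)).add
      ((((hsinA 0).pow 4).mul ((hsinA 2).pow 4)).mul (hterm 1))).add
      ((((hsinA 0).pow 4).mul ((hsinA 1).pow 4)).mul (hterm 2))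
  obtain ⟨z₀, hz₀⟩ := hU'
  have hG0 : G =ᶠ[𝓝 z₀] 0 := by
    filter_upwards [hU.mem_nhds hz₀] with z hz
    have h := hBD z hz
    have s0 := hsin z hz 0
    have s1 := hsin z hz 1
    have s2 := hsin z hz 2
    rw [Fin.sum_univ_three] at h
    have clear : ∀ {s₀ s₁ s₂ t₀ t₁ t₂ : ℝ}, s₀ ≠ 0 → s₁ ≠ 0 → s₂ ≠ 0 →
        t₀ / s₀ ^ 4 + t₁ / s₁ ^ 4 + t₂ / s₂ ^ 4 = 0 →
        s₁ ^ 4 * s₂ ^ 4 * t₀ + s₀ ^ 4 * s₂ ^ 4 * t₁ + s₀ ^ 4 * s₁ ^ 4 * t₂ = 0 := by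
      intro s₀ s₁ s₂ t₀ t₁ t₂ h₀ h₁ h₂ h
      field_simp at h
      linear_combination h
    exact clear s0 s1 s2 h
  have hGz : ∀ z, G z = 0 := fun z =>
    hG.eqOn_zero_of_preconnected_of_eventuallyEq_zero isPreconnected_univ (Set.mem_univ z₀) hG0
      (Set.mem_univ z)
  have h3 : √3 * √3 = (3 : ℝ) := Real.mul_self_sqrt (by norm_num)
  have h3' : (√3 : ℝ) ≠ 0 := by positivity
  have hpi := Real.pi_pos
  -- evaluation on the mirrors, at points where the other two sines are `±1`
  have ev0 : ∀ z, Real.sin (θ 0 z) = 0 → Real.sin (θ 1 z) ^ 2 = 1 → Real.sin (θ 2 z) ^ 2 = 1 →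
      A 0 z = 0 := by
    intro z e0 e1 e2
    have e1' : Real.sin (θ 1 z) ^ 4 = 1 := by
      rw [show (4 : ℕ) = 2 * 2 from rfl, pow_mul, e1, one_pow]
    have e2' : Real.sin (θ 2 z) ^ 4 = 1 := by
      rw [show (4 : ℕ) = 2 * 2 from rfl, pow_mul, e2, one_pow]
    have := hGz z
    simp only [G, e0, e1', e2', darbouxTerm] at this
    linarith
  have ev1 : ∀ z, Real.sin (θ 1 z) = 0 → Real.sin (θ 0 z) ^ 2 = 1 → Real.sin (θ 2 z) ^ 2 = 1 →
      A 1 z = 0 := by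
    intro z e0 e1 e2
    have e1' : Real.sin (θ 0 z) ^ 4 = 1 := by
      rw [show (4 : ℕ) = 2 * 2 from rfl, pow_mul, e1, one_pow]
    have e2' : Real.sin (θ 2 z) ^ 4 = 1 := by
      rw [show (4 : ℕ) = 2 * 2 from rfl, pow_mul, e2, one_pow]
    have := hGz z
    simp only [G, e0, e1', e2', darbouxTerm] at this
    linarith
  have hθ0 : ∀ x y : ℝ, θ 0 ⟨x, y⟩ = x := fun x y => by simp [θ, mirrorNormal]
  have hθ1 : ∀ x y : ℝ, θ 1 ⟨x, y⟩ = (x + √3 * y) / 2 := fun x y => by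
    simp [θ, mirrorNormal]; ring
  have hθ2 : ∀ x y : ℝ, θ 2 ⟨x, y⟩ = (x - √3 * y) / 2 := fun x y => by
    simp [θ, mirrorNormal]; ring
  have s32 : Real.sin (3 * Real.pi / 2) = -1 := by
    rw [show 3 * Real.pi / 2 = Real.pi / 2 + Real.pi by ring, Real.sin_add_pi, Real.sin_pi_div_two]
  set y₀ : ℝ := Real.pi / √3 with hy₀
  have hy : √3 * y₀ = Real.pi := by rw [hy₀]; field_simp
  have a1 : A 0 ⟨0, y₀⟩ = 0 := by
    apply ev0
    · rw [hθ0, Real.sin_zero]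
    · rw [hθ1, hy, zero_add, Real.sin_pi_div_two, one_pow]
    · rw [hθ2, hy, zero_sub, neg_div, Real.sin_neg, Real.sin_pi_div_two]; norm_num
  have a2 : A 0 ⟨0, -y₀⟩ = 0 := by
    apply ev0
    · rw [hθ0, Real.sin_zero]
    · rw [hθ1, mul_neg, hy, zero_add, neg_div, Real.sin_neg, Real.sin_pi_div_two]; norm_num
    · rw [hθ2, mul_neg, hy, zero_sub, neg_neg, Real.sin_pi_div_two, one_pow]
  have a3 : A 0 ⟨2 * Real.pi, y₀⟩ = 0 := by
    apply ev0
    · rw [hθ0, Real.sin_two_pi]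
    · rw [hθ1, hy, show (2 * Real.pi + Real.pi) / 2 = 3 * Real.pi / 2 by ring, s32]; norm_num
    · rw [hθ2, hy, show (2 * Real.pi - Real.pi) / 2 = Real.pi / 2 by ring, Real.sin_pi_div_two,
        one_pow]
  have a4 : A 0 ⟨2 * Real.pi, -y₀⟩ = 0 := by
    apply ev0
    · rw [hθ0, Real.sin_two_pi]
    · rw [hθ1, mul_neg, hy, show (2 * Real.pi + -Real.pi) / 2 = Real.pi / 2 by ring,
        Real.sin_pi_div_two, one_pow]
    · rw [hθ2, mul_neg, hy, show (2 * Real.pi - -Real.pi) / 2 = 3 * Real.pi / 2 by ring, s32]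
      norm_num
  have a5 : A 1 ⟨Real.pi / 2, -(y₀ / 2)⟩ = 0 := by
    apply ev1
    · rw [hθ1, show (Real.pi / 2 + √3 * -(y₀ / 2)) / 2 = (Real.pi - √3 * y₀) / 4 by ring, hy,
        sub_self, zero_div, Real.sin_zero]
    · rw [hθ0, Real.sin_pi_div_two, one_pow]
    · rw [hθ2, show (Real.pi / 2 - √3 * -(y₀ / 2)) / 2 = (Real.pi + √3 * y₀) / 4 by ring, hy,
        show (Real.pi + Real.pi) / 4 = Real.pi / 2 by ring, Real.sin_pi_div_two, one_pow]
  have hA0 : ∀ x y : ℝ, A 0 ⟨x, y⟩ = 2 * c * x * y + 2 * (β.re * y + β.im * x) + γ.im := by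
    intro x y
    simp [A, mirrorNormal, pow_two]; ring
  have hA1 : c = 0 → β = 0 → γ.im = 0 → A 1 ⟨Real.pi / 2, -(y₀ / 2)⟩ = -(√3 / 2) * γ.re := by
    intro h1 h2 h4
    simp [A, mirrorNormal, pow_two, h1, h2, h4]
    ring
  rw [hA0] at a1 a2 a3 a4
  have hy0 : y₀ ≠ 0 := by rw [hy₀]; positivity
  have hβr : β.re = 0 := by
    have : β.re * y₀ = 0 := by linarith
    exact (mul_eq_zero.1 this).resolve_right hy0
  have hγi : γ.im = 0 := by rw [hβr] at a1; linarith
  have hc : c = 0 := by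
    rw [hβr] at a3 a4
    have : c * (Real.pi * y₀) = 0 := by linarith
    exact (mul_eq_zero.1 this).resolve_right (by positivity)
  have hβi : β.im = 0 := by
    rw [hβr, hc, hγi] at a3
    have : β.im * Real.pi = 0 := by linarith
    exact (mul_eq_zero.1 this).resolve_right hpi.ne'
  have hβ : β = 0 := Complex.ext hβr hβi
  rw [hA1 hc hβ hγi] at a5
  have hγ : γ = 0 := by
    refine Complex.ext ?_ hγi
    exact (mul_eq_zero.1 a5).resolve_left (by simp)
  intro z
  simp [hc, hβ, hγ]

theorem hasDerivAt_one_div_sin_sq {f : ℝ → ℝ} {f' t : ℝ} (hf : HasDerivAt f f' t)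
    (h0 : Real.sin (f t) ≠ 0) : HasDerivAt (fun t => 1 / Real.sin (f t) ^ 2)
      (-2 * Real.cos (f t) / Real.sin (f t) ^ 3 * f') t := by
  have h1 := ((Real.hasDerivAt_sin (f t)).comp t hf).fun_pow 2
  have h2 := h1.fun_inv (by simpa using h0)
  simp only [one_div]
  refine h2.congr_deriv ?_
  simp only [Function.comp]
  field_simp
  norm_num
  ring

theorem hasDerivAt_cos_div_sin_cube {f : ℝ → ℝ} {f' t : ℝ} (hf : HasDerivAt f f' t)
    (h0 : Real.sin (f t) ≠ 0) : HasDerivAt (fun t => -2 * Real.cos (f t) / Real.sin (f t) ^ 3)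
      ((6 - 4 * Real.sin (f t) ^ 2) / Real.sin (f t) ^ 4 * f') t := by
  have h1 := ((Real.hasDerivAt_sin (f t)).comp t hf).fun_pow 3
  have h3 := ((Real.hasDerivAt_cos (f t)).comp t hf).const_mul (-2)
  have h2 := h3.fun_div h1 (by simpa using h0)
  refine h2.congr_deriv ?_
  have hc := Real.cos_sq' (f t)
  simp only [Function.comp]
  field_simp
  rw [hc]
  ring

/-- In Liouville coordinates `w`, with the flat metric `|Z'|² |dw|²`, let both `|Z'|²` and
`|Z'|² V` be sums of a function of `Re w` and a function of `Im w`. The first condition says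
that `Z''' / Z'` is a real constant `c`, so that `Z'² = P(Z)` with a quadratic polynomial `P` whose
leading coefficient is `c`; the second one is then the Bertrand-Darboux equation for `P`. -/
theorem not_liouville_separable {k : ℝ} (hk0 : k ≠ 0) (hk1 : k ≠ -1) {O : Set ℂ} (hO : IsOpen O)
    (hne : O.Nonempty) {Z : ℂ → ℂ} (hZ : DifferentiableOn ℂ Z O) (hZ' : ∀ w ∈ O, deriv Z w ≠ 0)
    (hsin : ∀ w ∈ O, ∀ j, Real.sin ((mirrorNormal j * Z w).re) ≠ 0)
    {F₀ F₁ h₀ h₁ : ℝ → ℝ} (hF : ∀ w ∈ O, Complex.normSq (deriv Z w) = F₀ w.re + F₁ w.im)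
    (hh : ∀ w ∈ O, Complex.normSq (deriv Z w) * potentialZ k (Z w) = h₀ w.re + h₁ w.im) :
    False := by
  set Z₁ := deriv Z with hZ₁
  set Z₂ := deriv Z₁ with hZ₂
  set Z₃ := deriv Z₂ with hZ₃
  have hd1 : DifferentiableOn ℂ Z₁ O := hZ.deriv hO
  have hd2 : DifferentiableOn ℂ Z₂ O := hd1.deriv hO
  have hd3 : DifferentiableOn ℂ Z₃ O := hd2.deriv hO
  have D0 : ∀ w ∈ O, HasDerivAt Z (Z₁ w) w := fun w hw =>
    (hZ.differentiableAt (hO.mem_nhds hw)).hasDerivAt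
  have D1 : ∀ w ∈ O, HasDerivAt Z₁ (Z₂ w) w := fun w hw =>
    (hd1.differentiableAt (hO.mem_nhds hw)).hasDerivAt
  have D2 : ∀ w ∈ O, HasDerivAt Z₂ (Z₃ w) w := fun w hw =>
    (hd2.differentiableAt (hO.mem_nhds hw)).hasDerivAt
  -- the conformal factor and its derivative in the imaginary direction
  let N : ℂ → ℝ := fun w => (Z₁ w).re ^ 2 + (Z₁ w).im ^ 2
  let NI : ℂ → ℝ := fun w => 2 * ((Z₁ w).im * (Z₂ w).re - (Z₁ w).re * (Z₂ w).im)
  let NR : ℂ → ℝ := fun w => 2 * ((Z₁ w).re * (Z₂ w).re + (Z₁ w).im * (Z₂ w).im)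
  have hN : ∀ w, Complex.normSq (Z₁ w) = N w := fun w => by
    simp only [Complex.normSq_apply, N]; ring
  have dN : ∀ w ∈ O, ∀ d : ℂ, HasDerivAt (fun t : ℝ => N (w + t * d))
      (d.re * NR w + d.im * NI w) 0 := by
    intro w hw d
    have h := (D1 w hw).comp_line d
    refine ((h.re_comp.fun_pow 2).fun_add (h.im_comp.fun_pow 2)).congr_deriv ?_
    simp [NR, NI]; ring
  have dNI : ∀ w ∈ O, HasDerivAt (fun t : ℝ => NI (w + t * 1))
      (2 * ((Z₁ w).im * (Z₃ w).re - (Z₁ w).re * (Z₃ w).im)) 0 := by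
    intro w hw
    have e1 := (D1 w hw).comp_line 1
    have e2 := (D2 w hw).comp_line 1
    refine (((e1.im_comp.fun_mul e2.re_comp).fun_sub
      (e1.re_comp.fun_mul e2.im_comp)).const_mul 2).congr_deriv ?_
    simp; ring
  have hreal : ∀ w ∈ O, (Z₁ w).im * (Z₃ w).re - (Z₁ w).re * (Z₃ w).im = 0 := by
    intro w hw
    have := mixed_deriv_eq_zero hO (Φ := N) (Φ' := NI) (fun w hw => (hN w).symm.trans (hF w hw))
      (fun w hw => by simpa using dN w hw Complex.I) hw (dNI w hw)
    linarith
  -- the mixed derivative of `N * V`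
  let S : Fin 3 → ℂ → ℝ := fun j w => 1 / Real.sin ((mirrorNormal j * Z w).re) ^ 2
  let T : Fin 3 → ℂ → ℝ := fun j w =>
    -2 * Real.cos ((mirrorNormal j * Z w).re) / Real.sin ((mirrorNormal j * Z w).re) ^ 3
  let K : ℝ := 3 * k * (1 + k)
  let W : ℂ → ℝ := fun w => potentialZ k (Z w)
  let WI : ℂ → ℝ := fun w => K * ∑ j, T j w * (Complex.I * (mirrorNormal j * Z₁ w)).re
  let WR : ℂ → ℝ := fun w => K * ∑ j, T j w * (1 * (mirrorNormal j * Z₁ w)).re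
  have dθ : ∀ w ∈ O, ∀ d : ℂ, ∀ j, HasDerivAt (fun t : ℝ => (mirrorNormal j * Z (w + t * d)).re)
      (d * (mirrorNormal j * Z₁ w)).re 0 := by
    intro w hw d j
    have := (((D0 w hw).comp_line d).const_mul (mirrorNormal j)).re_comp
    refine this.congr_deriv ?_
    congr 1; ring
  have dW : ∀ w ∈ O, ∀ d : ℂ, HasDerivAt (fun t : ℝ => W (w + t * d))
      (K * ∑ j, T j w * (d * (mirrorNormal j * Z₁ w)).re) 0 := by
    intro w hw d
    have hs : ∀ j, HasDerivAt (fun t : ℝ => S j (w + t * d))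
        (T j w * (d * (mirrorNormal j * Z₁ w)).re) 0 := by
      intro j
      have h0 : Real.sin ((mirrorNormal j * Z (w + ((0 : ℝ) : ℂ) * d)).re) ≠ 0 := by
        simpa using hsin w hw j
      simpa [S, T] using hasDerivAt_one_div_sin_sq (dθ w hw d j) h0
    exact ((HasDerivAt.fun_sum fun j _ => hs j).const_mul K).const_add _
  have dWI : ∀ w ∈ O, HasDerivAt (fun t : ℝ => WI (w + t * 1))
      (K * ∑ j, ((6 - 4 * Real.sin ((mirrorNormal j * Z w).re) ^ 2)
          / Real.sin ((mirrorNormal j * Z w).re) ^ 4 * (1 * (mirrorNormal j * Z₁ w)).re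
          * (Complex.I * (mirrorNormal j * Z₁ w)).re
        + T j w * (Complex.I * (mirrorNormal j * Z₂ w)).re)) 0 := by
    intro w hw
    refine HasDerivAt.const_mul K (HasDerivAt.fun_sum fun j _ => ?_)
    have h0 : Real.sin ((mirrorNormal j * Z (w + ((0 : ℝ) : ℂ) * 1)).re) ≠ 0 := by
      simpa using hsin w hw j
    have e1 := hasDerivAt_cos_div_sin_cube (dθ w hw 1 j) h0
    have e2 := ((((D1 w hw).comp_line 1).const_mul (mirrorNormal j)).const_mul Complex.I).re_comp
    refine (e1.fun_mul e2).congr_deriv ?_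
    simp [T]
  have hmixed : ∀ w ∈ O, ∑ j, darbouxTerm ((mirrorNormal j ^ 2 * Z₁ w ^ 2).im)
      ((mirrorNormal j * Z₂ w).im) ((mirrorNormal j * Z w).re)
        / Real.sin ((mirrorNormal j * Z w).re) ^ 4 = 0 := by
    intro w hw
    have hΦ' : ∀ w ∈ O, HasDerivAt (fun t : ℝ => N (w + t * Complex.I) * W (w + t * Complex.I))
        (NI w * W w + N w * WI w) 0 := by
      intro w hw
      refine ((dN w hw Complex.I).fun_mul (dW w hw Complex.I)).congr_deriv ?_
      simp [WI]
    have hd := ((dNI w hw).fun_mul (dW w hw 1)).fun_add ((dN w hw 1).fun_mul (dWI w hw))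
    have hz := mixed_deriv_eq_zero hO (Φ := fun w => N w * W w)
      (Φ' := fun w => NI w * W w + N w * WI w)
      (fun w hw => by rw [← hh w hw, hN]) hΦ' hw hd
    have hK : K ≠ 0 := by
      have : 1 + k ≠ 0 := fun h => hk1 (by linarith)
      simp only [K]; positivity
    have hNpos : N w ≠ 0 := by
      rw [← hN]; exact (Complex.normSq_pos.2 (hZ' w hw)).ne'
    rw [hreal w hw] at hz
    refine (mul_eq_zero_iff_left (neg_ne_zero.2 (mul_ne_zero hK hNpos))).1 ?_
    rw [← hz]
    have s0 := hsin w hw 0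
    have s1 := hsin w hw 1
    have s2 := hsin w hw 2
    have key : ∀ j, Real.sin ((mirrorNormal j * Z w).re) ≠ 0 →
        -N w * (darbouxTerm ((mirrorNormal j ^ 2 * Z₁ w ^ 2).im)
          ((mirrorNormal j * Z₂ w).im) ((mirrorNormal j * Z w).re)
            / Real.sin ((mirrorNormal j * Z w).re) ^ 4) =
        NI w * (T j w * (mirrorNormal j * Z₁ w).re)
          + NR w * (T j w * (Complex.I * (mirrorNormal j * Z₁ w)).re)
          + N w * ((6 - 4 * Real.sin ((mirrorNormal j * Z w).re) ^ 2)
            / Real.sin ((mirrorNormal j * Z w).re) ^ 4 * (mirrorNormal j * Z₁ w).re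
            * (Complex.I * (mirrorNormal j * Z₁ w)).re
            + T j w * (Complex.I * (mirrorNormal j * Z₂ w)).re) := by
      intro j hs
      simp only [T, darbouxTerm]
      generalize Real.sin ((mirrorNormal j * Z w).re) = s at *
      generalize Real.cos ((mirrorNormal j * Z w).re) = c at *
      simp only [N, NI, NR, pow_two (mirrorNormal j), pow_two (Z₁ w), Complex.mul_re,
        Complex.mul_im, Complex.I_re, Complex.I_im]
      field_simp
      ring
    have k0 := key 0 s0
    have k1 := key 1 s1
    have k2 := key 2 s2
    simp only [WI, Fin.sum_univ_three, Complex.ofReal_zero, zero_mul, add_zero, mul_zero, zero_add,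
      Complex.one_re, Complex.one_im, one_mul] at k0 k1 k2 ⊢
    linear_combination K * k0 + K * k1 + K * k2
  -- a ball, on which the constants of integration are determined
  obtain ⟨w₀, hw₀⟩ := hne
  obtain ⟨ε, hε, hB⟩ := Metric.isOpen_iff.1 hO w₀ hw₀
  set B := Metric.ball w₀ ε
  have hBo : IsOpen B := Metric.isOpen_ball
  have hBc : IsPreconnected B := (convex_ball w₀ ε).isPreconnected
  obtain ⟨c, hc⟩ := exists_const_of_im_eq_zero hBo hBc (g := fun w => Z₃ w / Z₁ w)
    ((hd3.mono hB).fun_div (hd1.mono hB) fun w hw => hZ' w (hB hw)) (by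
      intro w hw
      have h1 := hreal w (hB hw)
      rw [Complex.div_im]
      rw [← sub_div]
      have : (Z₃ w).im * (Z₁ w).re - (Z₃ w).re * (Z₁ w).im = 0 := by linarith
      rw [this, zero_div])
  have hc' : ∀ w ∈ B, Z₃ w = c * Z₁ w := fun w hw =>
    (div_eq_iff (hZ' w (hB hw))).1 (hc w hw)
  obtain ⟨β, hβ⟩ := hBo.exists_is_const_of_deriv_eq_zero hBc (f := fun w => Z₂ w - c * Z w)
    ((hd2.mono hB).fun_sub ((hZ.mono hB).const_mul _)) (by
      intro w hw
      rw [((D2 w (hB hw)).fun_sub ((D0 w (hB hw)).const_mul _)).deriv, hc' w hw]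
      simp)
  have hβ' : ∀ w ∈ B, Z₂ w = c * Z w + β := fun w hw => by rw [← hβ w hw]; ring
  obtain ⟨γ, hγ⟩ := hBo.exists_is_const_of_deriv_eq_zero hBc
    (f := fun w => Z₁ w ^ 2 - (c * Z w ^ 2 + 2 * β * Z w))
    (((hd1.mono hB).fun_pow 2).fun_sub ((((hZ.mono hB).fun_pow 2).const_mul _).fun_add
      ((hZ.mono hB).const_mul _))) (by
      intro w hw
      have e0 := D0 w (hB hw)
      rw [(((D1 w (hB hw)).fun_pow 2).fun_sub (((e0.fun_pow 2).const_mul (c : ℂ)).fun_add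
        (e0.const_mul (2 * β)))).deriv, hβ' w hw]
      simp; ring)
  have hγ' : ∀ w ∈ B, Z₁ w ^ 2 = c * Z w ^ 2 + 2 * β * Z w + γ := fun w hw => by
    rw [← hγ w hw]; ring
  have hw₀B : w₀ ∈ B := Metric.mem_ball_self hε
  have hopen : Z '' B ∈ 𝓝 (Z w₀) := by
    have hst : HasStrictDerivAt Z (Z₁ w₀) w₀ :=
      (hZ.analyticAt (hO.mem_nhds hw₀)).hasStrictDerivAt
    rw [← hst.map_nhds_eq (hZ' w₀ hw₀)]
    exact Filter.image_mem_map (hBo.mem_nhds hw₀B)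
  have hP := darboux_trivial (U := interior (Z '' B)) (c := c) (β := β) (γ := γ) isOpen_interior
    ⟨Z w₀, mem_interior_iff_mem_nhds.2 hopen⟩
    (by
      intro z hz
      obtain ⟨w, hw, rfl⟩ := interior_subset hz
      exact hsin w (hB hw))
    (by
      intro z hz
      obtain ⟨w, hw, rfl⟩ := interior_subset hz
      rw [← hβ' w hw, ← hγ' w hw]
      exact hmixed w (hB hw))
  exact hZ' w₀ hw₀ (pow_eq_zero_iff two_ne_zero |>.1 ((hγ' w₀ hw₀B).trans (hP _)))

/-! ### Separation in the four types of coordinates -/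

/-- An isotropic complex coordinate of the flat `(L₁, L₂)` plane, scaled so that the mirrors are
the lines `Re (n_j z) ∈ πℤ`. -/
noncomputable def zCoord (L : Plane) : ℂ :=
  ⟨2 * Real.pi * L 0 + Real.pi * L 1, -(Real.pi * √3 * L 1)⟩

theorem mirrorNormal_mul_zCoord (L : Plane) :
    (mirrorNormal 0 * zCoord L).re = 2 * Real.pi * L 0 + Real.pi * L 1 ∧
    (mirrorNormal 1 * zCoord L).re = Real.pi * L 0 - Real.pi * L 1 ∧
    (mirrorNormal 2 * zCoord L).re = Real.pi * L 0 + 2 * Real.pi * L 1 := by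
  have h3 : √3 * √3 = (3 : ℝ) := Real.mul_self_sqrt (by norm_num)
  refine ⟨?_, ?_, ?_⟩
  · simp [mirrorNormal, zCoord]
  · simp [mirrorNormal, zCoord]
    linear_combination (-Real.pi * L 1 / 2) * h3
  · simp [mirrorNormal, zCoord]
    linear_combination (Real.pi * L 1 / 2) * h3

theorem potentialZ_zCoord (k : ℝ) (L : Plane) : potentialZ k (zCoord L) = potentialL k L := by
  obtain ⟨h0, h1, h2⟩ := mirrorNormal_mul_zCoord L
  rw [potentialZ, potentialL, Fin.sum_univ_three, h0, h1, h2]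
  ring

theorem sin_zCoord_ne_zero {L : Plane} (hL : L ∈ mirrorComplement) (j : Fin 3) :
    Real.sin ((mirrorNormal j * zCoord L).re) ≠ 0 := by
  obtain ⟨h0, h1, h2⟩ := mirrorNormal_mul_zCoord L
  fin_cases j
  · simpa [h0] using hL.2.1
  · simpa [h1] using hL.1
  · simpa [h2] using hL.2.2

/-- In Cartesian coordinates of the flat plane, the coordinate `z` is, up to a similarity,
`x + i y` or its conjugate. -/
theorem zCoord_affine {s : ℝ} (hs : 0 < s) (t : Plane) {M : Matrix (Fin 2) (Fin 2) ℝ}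
    (hM : M * Mᵀ = s ^ 2 • weightMetric) : ∃ (α : ℂ) (τ : ℝ), α ≠ 0 ∧ (τ = 1 ∨ τ = -1) ∧
      ∀ x : Plane, zCoord (t + M *ᵥ x) = zCoord t + α * ⟨x 0, τ * x 1⟩ := by
  have hpi := Real.pi_pos
  have h3 : √3 * √3 = (3 : ℝ) := Real.mul_self_sqrt (by norm_num)
  have h00 := congrFun (congrFun hM 0) 0
  have h01 := congrFun (congrFun hM 0) 1
  have h11 := congrFun (congrFun hM 1) 1
  simp [Matrix.mul_apply, Fin.sum_univ_two, weightMetric] at h00 h01 h11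
  field_simp at h00 h01 h11
  -- `α j` is the derivative of `z` along the `j`-th axis; isotropy says `α 0 ^ 2 + α 1 ^ 2 = 0`
  let α : Fin 2 → ℂ := fun j =>
    ⟨2 * Real.pi * M 0 j + Real.pi * M 1 j, -(Real.pi * √3 * M 1 j)⟩
  have hlin : ∀ x : Plane, zCoord (t + M *ᵥ x) = zCoord t + (α 0 * x 0 + α 1 * x 1) := by
    intro x
    apply Complex.ext <;>
    simp [zCoord, α] <;> ring
  have hsq : α 0 ^ 2 + α 1 ^ 2 = 0 := by
    apply Complex.ext
    · simp [α, pow_two]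
      linear_combination 4 * h00 + 2 * h01 + h11 - Real.pi ^ 2 * (M 1 0 ^ 2 + M 1 1 ^ 2) * h3
        - 3 * h11
    · simp [α, pow_two]
      linear_combination -(2 * √3) * h01 - 2 * √3 * h11
  have hα : α 0 ≠ 0 := by
    intro h
    rw [h, zero_pow two_ne_zero, zero_add, sq_eq_zero_iff] at hsq
    have e1 := congrArg Complex.im h
    have e2 := congrArg Complex.im hsq
    simp [α, hpi.ne'] at e1 e2
    rw [e1, e2] at h11
    simp at h11
    exact hs.ne' (pow_eq_zero_iff two_ne_zero |>.1 h11.symm)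
  have hfac : (α 1 - Complex.I * α 0) * (α 1 - -Complex.I * α 0) = 0 := by
    linear_combination hsq - α 0 ^ 2 * Complex.I_mul_I
  have hx : ∀ (τ : ℝ) (x : Plane), (⟨x 0, τ * x 1⟩ : ℂ) = x 0 + τ * Complex.I * x 1 := by
    intro τ x
    apply Complex.ext <;> simp
  rcases mul_eq_zero.1 hfac with h | h
  · refine ⟨α 0, 1, hα, Or.inl rfl, fun x => ?_⟩
    rw [hlin, hx, sub_eq_zero.1 h]
    push_cast; ring
  · refine ⟨α 0, -1, hα, Or.inr rfl, fun x => ?_⟩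
    rw [hlin, hx, sub_eq_zero.1 h]
    push_cast; ring

/-- Separation in coordinates that become conformal after a change `q₀ = a(Re w)` of the first
coordinate and a choice of orientation; `ζ` is the holomorphic map from `w` to `x ± i y`. -/
theorem not_separatesInType_of_conformal {k : ℝ} (hk0 : k ≠ 0) (hk1 : k ≠ -1)
    {κ : CoordinateType} {O : Set Plane} (hO : IsOpen O) {t : Plane}
    {M : Matrix (Fin 2) (Fin 2) ℝ} {α : ℂ} {τ : ℝ} (hα : α ≠ 0) (hτ : τ = 1 ∨ τ = -1)
    (hz : ∀ x : Plane, zCoord (t + M *ᵥ x) = zCoord t + α * ⟨x 0, τ * x 1⟩)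
    (hOS : ∀ q ∈ O, κ.weight q ≠ 0 ∧ t + M *ᵥ κ.chart q ∈ mirrorComplement)
    {f₁ f₂ : ℝ → ℝ} (hf : ∀ q ∈ O, potentialL k (t + M *ᵥ κ.chart q)
      = (κ.weight q)⁻¹ * (f₁ (q 0) + f₂ (q 1)))
    {F₀ F₁ : ℝ → ℝ} (hF : ∀ q, κ.weight q = F₀ (q 0) + F₁ (q 1))
    {a : ℝ → ℝ} (ha : Continuous a) {x y : ℝ} (hxy : ![a x, y] ∈ O)
    {ζ ζ' : ℂ → ℂ} (hζ : ∀ w, HasDerivAt ζ (ζ' w) w)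
    (hchart : ∀ w : ℂ, ζ w = ⟨κ.chart ![a w.re, τ * w.im] 0, τ * κ.chart ![a w.re, τ * w.im] 1⟩)
    (hweight : ∀ w : ℂ, Complex.normSq (ζ' w) = κ.weight ![a w.re, τ * w.im]) : False := by
  have hττ : τ * τ = 1 := by rcases hτ with rfl | rfl <;> norm_num
  let e : ℂ → Plane := fun w => ![a w.re, τ * w.im]
  have he : Continuous e := by
    refine continuous_pi fun i => ?_
    fin_cases i
    · exact ha.comp Complex.continuous_re
    · exact continuous_const.mul Complex.continuous_im
  have hZd : ∀ w, HasDerivAt (fun w => zCoord t + α * ζ w) (α * ζ' w) w := fun w =>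
    ((hζ w).const_mul α).const_add _
  have hZ : ∀ w, zCoord t + α * ζ w = zCoord (t + M *ᵥ κ.chart (e w)) := fun w => by
    rw [hz, hchart]
  have hW : ∀ w, Complex.normSq (deriv (fun w => zCoord t + α * ζ w) w)
      = Complex.normSq α * κ.weight (e w) := fun w => by
    rw [(hZd w).deriv, map_mul, hweight]
  refine not_liouville_separable hk0 hk1 (O := e ⁻¹' O) (hO.preimage he)
    ⟨⟨x, τ * y⟩, by simpa [e, ← mul_assoc, hττ] using hxy⟩
    (Z := fun w => zCoord t + α * ζ w) (fun w _ => (hZd w).differentiableAt.differentiableWithinAt)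
    ?_ ?_ (F₀ := fun x => Complex.normSq α * F₀ (a x))
    (F₁ := fun y => Complex.normSq α * F₁ (τ * y)) (h₀ := fun x => Complex.normSq α * f₁ (a x))
    (h₁ := fun y => Complex.normSq α * f₂ (τ * y)) ?_ ?_
  · intro w hw h
    have h1 := hW w
    rw [h, map_zero] at h1
    exact mul_ne_zero (Complex.normSq_pos.2 hα).ne' (hOS _ hw).1 h1.symm
  · intro w hw j
    simp only [hZ]
    exact sin_zCoord_ne_zero (hOS _ hw).2 j
  · intro w hw
    rw [hW, hF]
    simp [e]; ring
  · intro w hw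
    have h0 := (hOS _ hw).1
    rw [hW]
    simp only [hZ]
    rw [potentialZ_zCoord, hf _ hw]
    field_simp
    simp [e]

theorem not_separatesInType {k : ℝ} (hk0 : k ≠ 0) (hk1 : k ≠ -1) (κ : CoordinateType) :
    ¬ SeparatesInType κ weightMetric mirrorComplement (potentialL k) := by
  rintro ⟨s, t, M, hs, hM, O, hO, ⟨q, hq⟩, hOS, f₁, f₂, hf⟩
  obtain ⟨α, τ, hα, hτ, hz⟩ := zCoord_affine hs t hM
  have hq' : ![q 0, q 1] ∈ O := by
    have : ![q 0, q 1] = q := by ext i; fin_cases i <;> rfl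
    rwa [this]
  have hττ : τ * τ = 1 := by rcases hτ with rfl | rfl <;> norm_num
  cases κ with
  | cartesian =>
    refine not_separatesInType_of_conformal hk0 hk1 hO hα hτ hz hOS hf (F₀ := fun _ => 1)
      (F₁ := fun _ => 0) (fun q => by simp [CoordinateType.weight]) (a := id) continuous_id hq'
      (ζ := fun w => w) (ζ' := fun _ => 1) (fun w => hasDerivAt_id' w) ?_ ?_
    · intro w
      apply Complex.ext <;> simp [CoordinateType.chart, ← mul_assoc, hττ]
    · intro w; simp [CoordinateType.weight]
  | polar =>
    -- `q₀` may be negative; its sign is constant along `q₀ = ± exp (Re w)`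
    have hq0 : q 0 ≠ 0 := by
      have := (hOS q hq).1
      simpa [CoordinateType.weight] using this
    obtain ⟨ε, hε, hεq⟩ : ∃ ε : ℝ, ε * ε = 1 ∧ ε * Real.exp (Real.log |q 0|) = q 0 := by
      rw [Real.exp_log (abs_pos.2 hq0)]
      rcases lt_or_gt_of_ne hq0 with h | h
      · exact ⟨-1, by norm_num, by rw [abs_of_neg h]; ring⟩
      · exact ⟨1, by norm_num, by rw [abs_of_pos h]; ring⟩
    refine not_separatesInType_of_conformal hk0 hk1 hO hα hτ hz hOS hf (F₀ := fun r => r ^ 2)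
      (F₁ := fun _ => 0) (fun q => by simp [CoordinateType.weight])
      (a := fun x => ε * Real.exp x) (by fun_prop) (x := Real.log |q 0|) (y := q 1)
      (by rw [hεq]; exact hq') (ζ := fun w => ε * Complex.exp w)
      (ζ' := fun w => ε * Complex.exp w) (fun w => (Complex.hasDerivAt_exp w).const_mul _) ?_ ?_
    · intro w
      apply Complex.ext <;>
      rcases hτ with rfl | rfl <;> simp [CoordinateType.chart, Complex.exp_re, Complex.exp_im] <;>
        ring
    · intro w
      have := Real.sin_sq_add_cos_sq w.im
      simp [CoordinateType.weight, Complex.normSq_apply, Complex.exp_re, Complex.exp_im]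
      linear_combination (ε ^ 2 * Real.exp w.re ^ 2) * this
  | parabolic =>
    refine not_separatesInType_of_conformal hk0 hk1 hO hα hτ hz hOS hf (F₀ := fun p => p ^ 2)
      (F₁ := fun p => p ^ 2) (fun q => by simp [CoordinateType.weight]) (a := id) continuous_id hq'
      (ζ := fun w => w ^ 2 / 2) (ζ' := fun w => w)
      (fun w => by simpa using ((hasDerivAt_id' w).pow 2).div_const 2) ?_ ?_
    · intro w
      apply Complex.ext <;>
      rcases hτ with rfl | rfl <;> simp [CoordinateType.chart, pow_two] <;> ring
    · intro w
      rcases hτ with rfl | rfl <;> simp [CoordinateType.weight, Complex.normSq_apply] <;> ring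
  | elliptic =>
    have hcs : ∀ w : ℂ, Complex.cosh w = ⟨Real.cosh w.re * Real.cos w.im,
        Real.sinh w.re * Real.sin w.im⟩ := fun w => by
      conv_lhs => rw [← Complex.re_add_im w]
      rw [Complex.cosh_add, Complex.cosh_mul_I, Complex.sinh_mul_I]
      apply Complex.ext <;> simp [Complex.cosh_ofReal_re, Complex.sinh_ofReal_re,
        Complex.cos_ofReal_re, Complex.sin_ofReal_re]
    have hsn : ∀ w : ℂ, Complex.sinh w = ⟨Real.sinh w.re * Real.cos w.im,
        Real.cosh w.re * Real.sin w.im⟩ := fun w => by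
      conv_lhs => rw [← Complex.re_add_im w]
      rw [Complex.sinh_add, Complex.cosh_mul_I, Complex.sinh_mul_I]
      apply Complex.ext <;> simp [Complex.cosh_ofReal_re, Complex.sinh_ofReal_re,
        Complex.cos_ofReal_re, Complex.sin_ofReal_re]
    refine not_separatesInType_of_conformal hk0 hk1 hO hα hτ hz hOS hf
      (F₀ := fun x => Real.cosh x ^ 2) (F₁ := fun y => -Real.cos y ^ 2)
      (fun q => by simp [CoordinateType.weight, sub_eq_add_neg]) (a := id) continuous_id hq'
      (ζ := Complex.cosh) (ζ' := Complex.sinh) Complex.hasDerivAt_cosh ?_ ?_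
    · intro w
      rw [hcs]
      apply Complex.ext <;>
      rcases hτ with rfl | rfl <;> simp [CoordinateType.chart]
    · intro w
      have h1 := Real.cosh_sq w.re
      have h2 := Real.sin_sq w.im
      rcases hτ with rfl | rfl <;> simp [CoordinateType.weight, Complex.normSq_apply, hsn] <;>
      linear_combination (Real.cosh w.re ^ 2) * h2 - Real.cos w.im ^ 2 * h1

/-! ### Pulling back separating coordinates to the flat plane -/

theorem fderiv_apply_eq_pd (f : Plane → ℝ) (p v : Plane) :
    fderiv ℝ f p v = v 0 * pd 0 f p + v 1 * pd 1 f p := by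
  have hv : v = v 0 • (Pi.single 0 1 : Plane) + v 1 • (Pi.single 1 1 : Plane) := by
    ext i; fin_cases i <;> simp
  conv_lhs => rw [hv, map_add, map_smul, map_smul]
  rfl

/-- A map with nonzero Jacobian satisfies the hypothesis of the inverse function theorem. -/
theorem exists_hasStrictFDerivAt_equiv {Q : Plane → Plane} {p : Plane}
    (hQ : ∀ i, ContDiffAt ℝ ∞ (fun x => Q x i) p)
    (hJ : pd 0 (fun x => Q x 0) p * pd 1 (fun x => Q x 1) p
      - pd 1 (fun x => Q x 0) p * pd 0 (fun x => Q x 1) p ≠ 0) :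
    ∃ e : Plane ≃L[ℝ] Plane, HasStrictFDerivAt Q (e : Plane →L[ℝ] Plane) p := by
  have hst : HasStrictFDerivAt Q (ContinuousLinearMap.pi fun i => fderiv ℝ (fun x => Q x i) p) p :=
    hasStrictFDerivAt_pi.2 fun i => (hQ i).hasStrictFDerivAt (by simp)
  set T := ContinuousLinearMap.pi fun i => fderiv ℝ (fun x => Q x i) p with hT
  have hinj : Function.Injective (T : Plane →ₗ[ℝ] Plane) := by
    rw [← LinearMap.ker_eq_bot, LinearMap.ker_eq_bot']
    intro v hv
    have h0 := congrFun hv 0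
    have h1 := congrFun hv 1
    simp only [hT, ContinuousLinearMap.coe_coe, ContinuousLinearMap.coe_pi', Pi.zero_apply,
      fderiv_apply_eq_pd] at h0 h1
    ext i
    refine (mul_eq_zero_iff_left hJ).1 ?_
    fin_cases i
    · simp only [Fin.zero_eta]
      linear_combination pd 1 (fun x => Q x 1) p * h0 - pd 1 (fun x => Q x 0) p * h1
    · simp only [Fin.mk_one]
      linear_combination pd 0 (fun x => Q x 0) p * h1 - pd 0 (fun x => Q x 1) p * h0
  refine ⟨(LinearEquiv.ofInjectiveEndo _ hinj).toContinuousLinearEquiv, ?_⟩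
  have hT' : ((LinearEquiv.ofInjectiveEndo _ hinj).toContinuousLinearEquiv : Plane →L[ℝ] Plane)
      = T := by ext v i; rfl
  rw [hT']
  exact hst

theorem pd_comp_map {f : Plane → ℝ} {Q : Plane → Plane} {p : Plane}
    (hf : DifferentiableAt ℝ f (Q p)) (hQ : ∀ i, DifferentiableAt ℝ (fun x => Q x i) p)
    (j : Fin 2) : pd j (fun x => f (Q x)) p
      = pd 0 f (Q p) * pd j (fun x => Q x 0) p + pd 1 f (Q p) * pd j (fun x => Q x 1) p := by
  have hst := hasFDerivAt_pi.2 fun i => (hQ i).hasFDerivAt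
  have := (hf.hasFDerivAt.comp p hst).pd_eq j
  simp only [Function.comp_def] at this
  rw [this, ContinuousLinearMap.comp_apply, fderiv_apply_eq_pd]
  simp [pd]; ring

theorem covariantMetric_const (G : Matrix (Fin 2) (Fin 2) ℝ) (i j : Fin 2) :
    covariantMetric (fun _ => G) i j = fun _ => G⁻¹ i j := rfl

theorem laplaceBeltrami_const (G : Matrix (Fin 2) (Fin 2) ℝ) (f : Plane → ℝ) (p : Plane) :
    laplaceBeltrami (fun _ => G) f p = ∑ i, ∑ j, G i j * pd i (pd j f) p := by
  simp [laplaceBeltrami, christoffel, covariantMetric_const, pd_const]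

/-- The Laplace-Beltrami operators of the flat plane and of the deltoid correspond to each other
under the character map. -/
theorem laplaceBeltrami_comp_characterMap {f : Plane → ℝ} {L : Plane}
    (hL : L ∈ mirrorComplement) (hf : ContDiffAt ℝ ∞ f (characterMap L)) :
    laplaceBeltrami (fun _ => weightMetric) (fun x => f (characterMap x)) L
      = laplaceBeltrami deltoidMetric f (characterMap L) := by
  have hχ : ∀ i x, DifferentiableAt ℝ (fun x => characterMap x i) x := fun i x =>
    (contDiff_characterMap_apply i).contDiffAt.differentiableAt_infty
  have hχ2 : ∀ i j x, DifferentiableAt ℝ (pd j fun x => characterMap x i) x := fun i j x =>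
    ((contDiff_characterMap_apply i).contDiffAt.pd j).differentiableAt_infty
  have hev : ∀ᶠ x in 𝓝 L, ContDiffAt ℝ 1 f (characterMap x) :=
    contDiff_characterMap.continuous.continuousAt.eventually
      ((hf.of_le (by simp)).eventually (by simp))
  have hcomp : ∀ i, DifferentiableAt ℝ (fun x => pd i f (characterMap x)) L := fun i =>
    (hf.pd i).differentiableAt_infty.comp L
      (contDiff_characterMap.contDiffAt.differentiableAt (by simp))
  have hsecond : ∀ i j, pd i (pd j fun x => f (characterMap x)) L =
      (pd 0 (pd 0 f) (characterMap L) * pd i (fun x => characterMap x 0) L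
        + pd 1 (pd 0 f) (characterMap L) * pd i (fun x => characterMap x 1) L)
          * pd j (fun x => characterMap x 0) L
      + pd 0 f (characterMap L) * pd i (pd j fun x => characterMap x 0) L
      + ((pd 0 (pd 1 f) (characterMap L) * pd i (fun x => characterMap x 0) L
        + pd 1 (pd 1 f) (characterMap L) * pd i (fun x => characterMap x 1) L)
          * pd j (fun x => characterMap x 1) L
      + pd 1 f (characterMap L) * pd i (pd j fun x => characterMap x 1) L) := by
    intro i j
    have h1 : (pd j fun x => f (characterMap x)) =ᶠ[𝓝 L] fun x =>
        pd 0 f (characterMap x) * pd j (fun x => characterMap x 0) x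
        + pd 1 f (characterMap x) * pd j (fun x => characterMap x 1) x := by
      filter_upwards [hev] with x hx
      exact pd_comp_map (hx.differentiableAt (by simp)) (fun i => hχ i x) j
    rw [pd_congr h1, pd_add ((hcomp 0).fun_mul (hχ2 0 j L)) ((hcomp 1).fun_mul (hχ2 1 j L)),
      pd_mul (hcomp 0) (hχ2 0 j L), pd_mul (hcomp 1) (hχ2 1 j L),
      pd_comp_map (hf.pd 0).differentiableAt_infty (fun i => hχ i L),
      pd_comp_map (hf.pd 1).differentiableAt_infty (fun i => hχ i L)]
  have hne : deltoidPoly (characterMap L) ≠ 0 := ne_of_lt (characterMap_mem hL)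
  rw [laplaceBeltrami_const, laplaceBeltrami_deltoid hne]
  have i00 := characterMap_isometry L 0 0
  have i01 := characterMap_isometry L 0 1
  have i10 := characterMap_isometry L 1 0
  have i11 := characterMap_isometry L 1 1
  have l0 := laplacian_characterMap L 0
  have l1 := laplacian_characterMap L 1
  simp only [Fin.sum_univ_two, hsecond] at i00 i01 i10 i11 l0 l1 ⊢
  linear_combination pd 0 (pd 0 f) (characterMap L) * i00 + pd 0 (pd 1 f) (characterMap L) * i01
    + pd 1 (pd 0 f) (characterMap L) * i10 + pd 1 (pd 1 f) (characterMap L) * i11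
    + pd 0 f (characterMap L) * l0 + pd 1 f (characterMap L) * l1

theorem gradientOp_comp_characterMap {f h : Plane → ℝ} {L : Plane}
    (hf : DifferentiableAt ℝ f (characterMap L)) (hh : DifferentiableAt ℝ h (characterMap L)) :
    gradientOp (fun _ => weightMetric) (fun x => f (characterMap x)) (fun x => h (characterMap x)) L
      = gradientOp deltoidMetric f h (characterMap L) := by
  have hχ : ∀ i, DifferentiableAt ℝ (fun x => characterMap x i) L := fun i =>
    (contDiff_characterMap_apply i).contDiffAt.differentiableAt_infty
  have i00 := characterMap_isometry L 0 0
  have i01 := characterMap_isometry L 0 1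
  have i10 := characterMap_isometry L 1 0
  have i11 := characterMap_isometry L 1 1
  simp only [Fin.sum_univ_two] at i00 i01 i10 i11
  simp only [gradientOp, Fin.sum_univ_two, pd_comp_map hf hχ, pd_comp_map hh hχ]
  linear_combination pd 0 f (characterMap L) * pd 0 h (characterMap L) * i00
    + pd 0 f (characterMap L) * pd 1 h (characterMap L) * i01
    + pd 1 f (characterMap L) * pd 0 h (characterMap L) * i10
    + pd 1 f (characterMap L) * pd 1 h (characterMap L) * i11

theorem jacobian_characterMap_ne_zero {L : Plane} (hL : L ∈ mirrorComplement) :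
    pd 0 (fun x => characterMap x 0) L * pd 1 (fun x => characterMap x 1) L
      - pd 1 (fun x => characterMap x 0) L * pd 0 (fun x => characterMap x 1) L ≠ 0 := by
  intro hJ
  have hne : deltoidPoly (characterMap L) ≠ 0 := ne_of_lt (characterMap_mem hL)
  have hdet := det_deltoidMetric (characterMap L)
  rw [Matrix.det_fin_two, ← characterMap_isometry, ← characterMap_isometry,
    ← characterMap_isometry, ← characterMap_isometry] at hdet
  simp only [Fin.sum_univ_two] at hdet
  apply hne
  -- `det (J G Jᵀ) = det G (det J)²`
  linear_combination (1 / 3) * hdet - (1 / 3) * (weightMetric 0 0 * weightMetric 1 1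
    - weightMetric 0 1 * weightMetric 1 0) * (pd 0 (fun x => characterMap x 0) L
      * pd 1 (fun x => characterMap x 1) L
      - pd 1 (fun x => characterMap x 0) L * pd 0 (fun x => characterMap x 1) L) * hJ

theorem isOpen_mirrorComplement : IsOpen mirrorComplement := by
  have h1 : Continuous fun L : Plane => Real.sin (Real.pi * L 0 - Real.pi * L 1) := by fun_prop
  have h2 : Continuous fun L : Plane => Real.sin (2 * Real.pi * L 0 + Real.pi * L 1) := by fun_prop
  have h3 : Continuous fun L : Plane => Real.sin (Real.pi * L 0 + 2 * Real.pi * L 1) := by fun_prop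
  exact (isOpen_ne_fun h1 continuous_const).inter
    ((isOpen_ne_fun h2 continuous_const).inter (isOpen_ne_fun h3 continuous_const))

theorem SolvableBySeparation.comp_characterMap {k : ℝ}
    (h : SolvableBySeparation deltoidDomain deltoidMetric (potentialUV k)) :
    SolvableBySeparation mirrorComplement (fun _ => weightMetric) (potentialL k) := by
  obtain ⟨W, hWD, ⟨p, hp⟩, q, ⟨hW, hq, hinj, hJ, horth⟩, hsep⟩ := h
  obtain ⟨L₀, hL₀, rfl⟩ : p ∈ characterMap '' mirrorComplement := by
    rw [characterMap_image]; exact hWD hp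
  have hχ : ∀ i L, ContDiffAt ℝ ∞ (fun x => characterMap x i) L := fun i L =>
    (contDiff_characterMap_apply i).contDiffAt
  obtain ⟨e, he⟩ := exists_hasStrictFDerivAt_equiv (fun i => hχ i L₀)
    (jacobian_characterMap_ne_zero hL₀)
  -- an open neighbourhood on which the character map has a left inverse
  obtain ⟨V, hV, hVo, hL₀V⟩ := eventually_nhds_iff.1 he.eventually_left_inverse
  have hVinj : Set.InjOn characterMap V := fun x hx y hy hxy => by
    rw [← hV x hx, ← hV y hy, hxy]
  have hqL : ∀ i, ∀ L, characterMap L ∈ W → ContDiffAt ℝ ∞ (q i) (characterMap L) :=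
    fun i L hL => (hq i).contDiffAt_of_isOpen hW hL
  refine ⟨characterMap ⁻¹' W ∩ (mirrorComplement ∩ V), fun L hL => hL.2.1, ⟨L₀, hp, hL₀, hL₀V⟩,
    fun i x => q i (characterMap x), ⟨?_, ?_, ?_, ?_, ?_⟩, ?_⟩
  · exact (hW.preimage contDiff_characterMap.continuous).inter (isOpen_mirrorComplement.inter hVo)
  · intro i L hL
    exact ((hqL i L hL.1).comp L contDiff_characterMap.contDiffAt).contDiffWithinAt
  · intro x hx y hy hxy
    exact hVinj hx.2.2 hy.2.2 (hinj hx.1 hy.1 hxy)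
  · intro L hL
    have hd : ∀ i, DifferentiableAt ℝ (fun x => characterMap x i) L := fun i =>
      (hχ i L).differentiableAt_infty
    have hqd : ∀ i, DifferentiableAt ℝ (q i) (characterMap L) := fun i =>
      (hqL i L hL.1).differentiableAt_infty
    simp only [pd_comp_map (hqd _) hd]
    intro h0
    refine mul_ne_zero (hJ _ hL.1) (jacobian_characterMap_ne_zero hL.2.1) ?_
    linear_combination h0
  · intro L hL
    rw [gradientOp_comp_characterMap (hqL 0 L hL.1).differentiableAt_infty
      (hqL 1 L hL.1).differentiableAt_infty]
    exact horth _ hL.1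
  · intro E
    obtain ⟨R, a, b, c, hR, hRAB⟩ := hsep E
    refine ⟨fun L => R (characterMap L), a, b, c, fun L hL => hR _ hL.1, ?_⟩
    intro A B hA hB L hL
    have hsm : ContDiffAt ℝ ∞ (fun x => A (q 0 x) * B (q 1 x)) (characterMap L) :=
      (hA.contDiffAt.comp _ (hqL 0 L hL.1)).mul (hB.contDiffAt.comp _ (hqL 1 L hL.1))
    rw [← hRAB A B hA hB _ hL.1]
    simp only [schrodinger]
    rw [laplaceBeltrami_comp_characterMap hL.2.1 hsm, potentialUV_characterMap k hL.2.1]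

/-! ### Separation of the spectral equation in orthogonal coordinates -/

theorem exists_injective_primitive {f : ℝ → ℝ} {a b : ℝ} (hab : a ≤ b)
    (hf : ContinuousOn f (Set.Icc a b)) (hpos : ∀ x ∈ Set.Icc a b, 0 < f x) :
    ∃ β : ℝ → ℝ, Function.Injective β ∧ ∀ x ∈ Set.Icc a b, HasDerivAt β (f x) x := by
  let g : ℝ → ℝ := Set.IccExtend hab ((Set.Icc a b).domRestrict f)
  have hg : Continuous g := hf.domRestrict.Icc_extend'
  have hd : ∀ x, HasDerivAt (fun u => ∫ t in a..u, g t) (g x) x := fun x =>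
    (hg.integral_hasStrictDerivAt a x).hasDerivAt
  refine ⟨_, (strictMono_of_hasDerivAt_pos hd fun x => hpos _ (Subtype.prop _)).injective, ?_⟩
  intro x hx
  have : g x = f x := by simp [g, Set.IccExtend_of_mem hab _ hx, Set.domRestrict]
  rw [← this]
  exact hd x

theorem pd_pd_half_sq {h : Plane → ℝ} {p : Plane} (hh : ContDiffAt ℝ ∞ h p) (i j : Fin 2) :
    pd i (pd j fun x => (h x - h p) ^ 2 / 2) p = pd i h p * pd j h p := by
  have h1 : ∀ᶠ x in 𝓝 p, ContDiffAt ℝ 1 h x := (hh.of_le (by simp)).eventually (by simp)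
  have h2 : (pd j fun x => (h x - h p) ^ 2 / 2) =ᶠ[𝓝 p] fun x => (h x - h p) * pd j h x := by
    filter_upwards [h1] with x hx
    have hd : DifferentiableAt ℝ h x := hx.differentiableAt (by simp)
    have hφ : HasDerivAt (fun s : ℝ => (s - h p) ^ 2 / 2) (h x - h p) (h x) := by
      have := (((hasDerivAt_id' (h x)).sub_const (h p)).fun_pow 2).div_const 2
      refine this.congr_deriv ?_
      simp
    exact pd_comp hφ hd j
  have hd := hh.differentiableAt_infty
  rw [pd_congr h2, pd_mul (hd.sub_const _) (hh.pd j).differentiableAt_infty,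
    pd_sub hd (differentiableAt_const _), pd_const]
  ring

/-- Testing the separated equation on the products `1 · 1`, `½ (q₀ - s)² · 1` and
`1 · ½ (q₁ - s)²` isolates the second and zeroth order coefficients. -/
theorem EquationSeparatesIn.coefficients {G : Matrix (Fin 2) (Fin 2) ℝ} {W : Set Plane}
    {q : Fin 2 → Plane → ℝ} {U : Plane → ℝ} {E : ℝ} (hW : IsOpen W)
    (hq : ∀ i, ContDiffOn ℝ ∞ (q i) W)
    (h : EquationSeparatesIn W q (schrodinger (fun _ => G) U) E) :
    ∃ (R : Plane → ℝ) (a c : Fin 2 → ℝ → ℝ), (∀ p ∈ W, R p ≠ 0) ∧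
      (∀ p ∈ W, ∀ i, a i (q i p) = -(R p * gradientOp (fun _ => G) (q i) (q i) p)) ∧
      ∀ p ∈ W, R p * (U p - E) = c 0 (q 0 p) + c 1 (q 1 p) := by
  obtain ⟨R, a, b, c, hR, H⟩ := h
  have hd1 : ∀ s₀ : ℝ, deriv (fun s : ℝ => (s - s₀) ^ 2 / 2) = fun s => s - s₀ := by
    intro s₀; funext s
    have := (((hasDerivAt_id' s).sub_const s₀).fun_pow 2).div_const 2
    rw [this.deriv]; simp
  have hd2 : ∀ s₀ : ℝ, deriv (fun s : ℝ => s - s₀) = fun _ => 1 := by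
    intro s₀; funext s
    exact ((hasDerivAt_id' s).sub_const s₀).deriv
  refine ⟨R, a, c, hR, ?_, ?_⟩
  · intro p hp i
    have hsm := fun i => (hq i).contDiffAt_of_isOpen hW hp
    fin_cases i
    · have := H (fun s => (s - q 0 p) ^ 2 / 2) (fun _ => 1) (by fun_prop) contDiff_const p hp
      simp only [mul_one, hd1, hd2, schrodinger, laplaceBeltrami_const, pd_pd_half_sq (hsm 0)] at this
      simp only [Fin.zero_eta, gradientOp, Fin.sum_univ_two] at this ⊢
      linear_combination -this
    · have := H (fun _ => 1) (fun s => (s - q 1 p) ^ 2 / 2) contDiff_const (by fun_prop) p hp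
      simp only [one_mul, hd1, hd2, schrodinger, laplaceBeltrami_const, pd_pd_half_sq (hsm 1)] at this
      simp only [Fin.mk_one, gradientOp, Fin.sum_univ_two] at this ⊢
      linear_combination -this
  · intro p hp
    have := H (fun _ => 1) (fun _ => 1) contDiff_const contDiff_const p hp
    simpa [schrodinger, laplaceBeltrami_const, pd_const, funext (pd_const _ _)] using this

/-- Near a point, coordinates that separate the equation for two values of `E` can be
rescaled to Liouville coordinates: in `β₀(q₀)`, `β₁(q₁)` the metric is conformal with factor `ρ`, and
both `ρ` and `ρ U` are sums of a function of `q₀` and a function of `q₁`. -/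
theorem exists_liouville_rescaling {G : Matrix (Fin 2) (Fin 2) ℝ} {W : Set Plane}
    {q : Fin 2 → Plane → ℝ} {U : Plane → ℝ} (hq : IsOrthogonalCoordinateSystem (fun _ => G) W q)
    (hpos : ∀ p ∈ W, ∀ i, 0 < gradientOp (fun _ => G) (q i) (q i) p)
    (hsep : ∀ E, EquationSeparatesIn W q (schrodinger (fun _ => G) U) E) {p₀ : Plane}
    (hp₀ : p₀ ∈ W) :
    ∃ W' ⊆ W, IsOpen W' ∧ p₀ ∈ W' ∧ ∃ (β δ : Fin 2 → ℝ → ℝ) (ρ : Plane → ℝ)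
      (F h : Fin 2 → ℝ → ℝ), (∀ i, Function.Injective (β i)) ∧ ∀ p ∈ W', 0 < ρ p ∧
        (∀ i, HasDerivAt (β i) (δ i (q i p)) (q i p) ∧ 0 < δ i (q i p) ∧
          δ i (q i p) ^ 2 * gradientOp (fun _ => G) (q i) (q i) p * ρ p = 1) ∧
        ρ p = F 0 (q 0 p) + F 1 (q 1 p) ∧ ρ p * U p = h 0 (q 0 p) + h 1 (q 1 p) := by
  obtain ⟨hW, hqs, hinj, hJ, -⟩ := hq
  -- two values of `E` suffice: `R` and `R'` turn out to be proportional, and `R U`, `R' (U - 1)`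
  -- separate additively
  obtain ⟨R, a, c, hR, ha, hc⟩ := (hsep 0).coefficients hW hqs
  obtain ⟨R', a', c', hR', ha', hc'⟩ := (hsep 1).coefficients hW hqs
  set γ : Fin 2 → Plane → ℝ := fun i => gradientOp (fun _ => G) (q i) (q i) with hγ
  have hγc : ∀ i, ContinuousOn (γ i) W := fun i => by
    have := fun j => (contDiffOn_pd (hqs i) hW j).continuousOn
    exact continuousOn_finsetSum _ fun j _ => continuousOn_finsetSum _ fun l _ =>
      (continuousOn_const.mul (this j)).mul (this l)
  let Q : Plane → Plane := fun x i => q i x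
  have hmap : ∀ p ∈ W, Filter.map Q (𝓝 p) = 𝓝 (Q p) := by
    intro p hp
    obtain ⟨e, he⟩ := exists_hasStrictFDerivAt_equiv (Q := Q)
      (fun i => (hqs i).contDiffAt_of_isOpen hW hp) (hJ p hp)
    exact he.map_nhds_eq_of_equiv
  let φ := Function.invFunOn Q W
  have hφ : ∀ p ∈ W, φ (Q p) = p := fun p hp => hinj.leftInvOn_invFunOn hp
  have hφc : ∀ p ∈ W, ContinuousAt φ (Q p) := by
    intro p hp
    rw [ContinuousAt, hφ p hp, ← hmap p hp, Filter.tendsto_map'_iff]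
    refine Filter.tendsto_id.congr' ?_
    filter_upwards [hW.mem_nhds hp] with x hx using (hφ x hx).symm
  have hQW : Q '' W ∈ 𝓝 (Q p₀) := by
    rw [← hmap p₀ hp₀]; exact Filter.image_mem_map (hW.mem_nhds hp₀)
  obtain ⟨r, hr, hrW⟩ := Metric.nhds_basis_closedBall.mem_iff.1 hQW
  -- the curve `curve i` through `p₀`, along which only the coordinate `q i` varies
  let I : Fin 2 → Set ℝ := fun i => Set.Icc (q i p₀ - r) (q i p₀ + r)
  let curve : Fin 2 → ℝ → Plane := fun i s => φ (Function.update (Q p₀) i s)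
  have hupd : ∀ i, ∀ s ∈ I i, ∃ p ∈ W, Q p = Function.update (Q p₀) i s := by
    intro i s hs
    refine hrW ?_
    rw [Metric.mem_closedBall, dist_pi_le_iff hr.le]
    intro j
    by_cases hij : j = i
    · subst hij
      rw [Function.update_self, Real.dist_eq, abs_le]
      exact ⟨by linarith [hs.1], by linarith [hs.2]⟩
    · rw [Function.update_of_ne hij, dist_self]; exact hr.le
  have hcurve : ∀ i, ∀ s ∈ I i, curve i s ∈ W ∧ Q (curve i s) = Function.update (Q p₀) i s := by
    intro i s hs
    obtain ⟨p, hp, hpe⟩ := hupd i s hs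
    simp only [curve, ← hpe, hφ p hp]
    exact ⟨hp, trivial⟩
  have hcq : ∀ i, ∀ s ∈ I i, q i (curve i s) = s := fun i s hs => by
    have := congrFun (hcurve i s hs).2 i
    rwa [Function.update_self] at this
  have hcq' : ∀ i j, j ≠ i → ∀ s ∈ I i, q j (curve i s) = q j p₀ := fun i j hij s hs => by
    have := congrFun (hcurve i s hs).2 j
    rwa [Function.update_of_ne hij] at this
  have hcc : ∀ i, ContinuousOn (curve i) (I i) := by
    intro i s hs
    obtain ⟨p, hp, hpe⟩ := hupd i s hs
    have h1 : ContinuousAt φ (Function.update (Q p₀) i s) := hpe ▸ hφc p hp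
    have h2 : Continuous fun s => Function.update (Q p₀) i s :=
      continuous_const.update i continuous_id
    exact (ContinuousAt.comp (f := fun s => Function.update (Q p₀) i s) h1
      h2.continuousAt).continuousWithinAt
  have hane : ∀ i, ∀ s ∈ I i, a i s ≠ 0 := by
    intro i s hs
    have h1 := ha _ (hcurve i s hs).1 i
    rw [hcq i s hs] at h1
    rw [h1]
    exact neg_ne_zero.2 (mul_ne_zero (hR _ (hcurve i s hs).1) (hpos _ (hcurve i s hs).1 i).ne')
  have hac : ∀ i, ContinuousOn (a i) (I i) := by
    intro i
    obtain ⟨j, hij⟩ := exists_ne i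
    have hmaps : Set.MapsTo (curve i) (I i) W := fun s hs => (hcurve i s hs).1
    have h1 : ContinuousOn (fun s => a j (q j p₀) * (γ i (curve i s) / γ j (curve i s))) (I i) :=
      continuousOn_const.mul (((hγc i).comp (hcc i) hmaps).div ((hγc j).comp (hcc i) hmaps)
        fun s hs => (hpos _ (hmaps hs) j).ne')
    refine h1.congr fun s hs => ?_
    have e1 := ha _ (hmaps hs) i
    have e2 := ha _ (hmaps hs) j
    rw [hcq i s hs] at e1
    rw [hcq' i j hij s hs] at e2
    have hj := (hpos _ (hmaps hs) j).ne'
    rw [e1, e2]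
    simp only [hγ]
    field_simp
  have hprim : ∀ i, ∃ β : ℝ → ℝ, Function.Injective β ∧
      ∀ s ∈ I i, HasDerivAt β (1 / √|a i s|) s := fun i =>
    exists_injective_primitive (by linarith)
      (continuousOn_const.div (hac i).abs.sqrt fun s hs =>
        (Real.sqrt_pos.2 (abs_pos.2 (hane i s hs))).ne')
      fun s hs => one_div_pos.2 (Real.sqrt_pos.2 (abs_pos.2 (hane i s hs)))
  choose β hβ hβd using hprim
  have hI : ∀ i, q i p₀ ∈ I i := fun i => ⟨by linarith, by linarith⟩
  have hQc : ContinuousOn Q W := continuousOn_pi.2 fun i => (hqs i).continuousOn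
  set α := a 1 (q 1 p₀) with hα
  set α' := a' 1 (q 1 p₀) with hα'
  have hα0 : α ≠ 0 := hane 1 _ (hI 1)
  have hα'0 : α' ≠ 0 := by
    rw [hα', ha' p₀ hp₀ 1]
    exact neg_ne_zero.2 (mul_ne_zero (hR' _ hp₀) (hpos _ hp₀ 1).ne')
  refine ⟨W ∩ Q ⁻¹' Metric.ball (Q p₀) r, Set.inter_subset_left,
    hQc.isOpen_inter_preimage hW Metric.isOpen_ball, ⟨hp₀, Metric.mem_ball_self hr⟩, β,
    fun i s => 1 / √|a i s|, fun p => |R p|,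
    fun i s => -α / |α| * (c i s - c' i s / (α' / α)), fun i s => -α / |α| * c i s, hβ, ?_⟩
  rintro p ⟨hp, hpr⟩
  have hpI : ∀ i, q i p ∈ I i := by
    intro i
    have := (dist_pi_lt_iff hr).1 hpr i
    rw [Real.dist_eq, abs_lt] at this
    exact ⟨by linarith [this.1], by linarith [this.2]⟩
  -- comparison with the point `x` with coordinates `(q₀(p), q₁(p₀))`
  obtain ⟨x, hx, hx0, hx1⟩ : ∃ x ∈ W, q 0 x = q 0 p ∧ q 1 x = q 1 p₀ :=
    ⟨curve 0 (q 0 p), (hcurve 0 _ (hpI 0)).1, hcq 0 _ (hpI 0), hcq' 0 1 (by decide) _ (hpI 0)⟩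
  have e1 := ha p hp 0
  have e2 := ha x hx 0
  have e3 := ha x hx 1
  have e1' := ha' p hp 0
  have e2' := ha' x hx 0
  have e3' := ha' x hx 1
  rw [hx0] at e2 e2'
  rw [hx1] at e3 e3'
  rw [← hα] at e3
  rw [← hα'] at e3'
  have hRp := hR p hp
  have hg0 := hpos p hp 0
  have gx0 := hpos x hx 0
  have gx1 := hpos x hx 1
  have hratio : R' p * α = α' * R p := by
    have h1 : R' p * R x = R' x * R p := by
      have : (R' p * R x) * (γ 0 p * γ 0 x) = (R' x * R p) * (γ 0 p * γ 0 x) := by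
        have t1 : R p * γ 0 p = R x * γ 0 x := by
          simp only [hγ]; linarith
        have t2 : R' p * γ 0 p = R' x * γ 0 x := by
          simp only [hγ]; linarith
        linear_combination (R x * γ 0 x) * t2 - R' x * γ 0 x * t1
      exact mul_right_cancel₀ (mul_pos hg0 gx0).ne' this
    rw [e3, e3']
    linear_combination (-gradientOp (fun _ => G) (q 1) (q 1) x) * h1
  have hsign : |R p| = -α / |α| * R p := by
    have h1 : 0 < R p * -α := by
      have t1 : R p * γ 0 p = R x * γ 0 x := by
        simp only [hγ]; linarith
      have h2 : (R p * -α) * γ 0 p = R x ^ 2 * γ 0 x * γ 1 x := by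
        rw [e3]
        linear_combination (R x * γ 1 x) * t1
      have h3 : 0 < R x ^ 2 * γ 0 x * γ 1 x :=
        mul_pos (mul_pos (sq_pos_of_ne_zero (hR x hx)) gx0) gx1
      rw [← h2] at h3
      exact pos_of_mul_pos_left h3 hg0.le
    have h2 : |R p| * |α| = R p * -α := by
      rw [← abs_neg α, ← abs_mul, abs_of_pos h1]
    have : |α| ≠ 0 := abs_ne_zero.2 hα0
    field_simp
    linarith
  refine ⟨abs_pos.2 hRp, fun i => ⟨hβd i _ (hpI i), ?_, ?_⟩, ?_, ?_⟩
  · exact one_div_pos.2 (Real.sqrt_pos.2 (abs_pos.2 (hane i _ (hpI i))))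
  · have hai := ha p hp i
    have hgi := hpos p hp i
    have habs : |a i (q i p)| = |R p| * γ i p := by
      rw [hai, abs_neg, abs_mul, abs_of_pos hgi]
    have hRa : 0 < |R p| := abs_pos.2 hRp
    have hgi' : 0 < γ i p := hgi
    change (1 / √|a i (q i p)|) ^ 2 * γ i p * |R p| = 1
    rw [habs, div_pow, Real.sq_sqrt (by positivity)]
    field_simp
  · refine hsign.trans ?_
    have f0 := hc p hp
    have f1 := hc' p hp
    have hR'p : R' p = α' / α * R p := by field_simp; linarith
    rw [hR'p] at f1
    have : R p = (c 0 (q 0 p) + c 1 (q 1 p)) - (c' 0 (q 0 p) + c' 1 (q 1 p)) / (α' / α) := by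
      rw [← f0, ← f1]
      field_simp
      ring
    rw [this]; beta_reduce; ring
  · have f0 := hc p hp
    rw [sub_zero] at f0
    beta_reduce
    rw [hsign, mul_assoc, f0]; ring

/-- Two orthogonal plane vectors of equal length and positive determinant satisfy the
Cauchy-Riemann relations. -/
theorem cauchyRiemann_of_orthogonal {a b c d : ℝ} (hn : a ^ 2 + b ^ 2 = c ^ 2 + d ^ 2)
    (ho : a * c + b * d = 0) (hJ : 0 < a * d - b * c) : d = a ∧ c = -b := by
  have h1 : (a * d - b * c) ^ 2 = (a ^ 2 + b ^ 2) ^ 2 := by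
    linear_combination (-(a ^ 2 + b ^ 2)) * hn - (a * c + b * d) * ho
  have h2 : a * d - b * c = a ^ 2 + b ^ 2 := by
    rcases sq_eq_sq_iff_eq_or_eq_neg.1 h1 with h | h
    · exact h
    · nlinarith [sq_nonneg a, sq_nonneg b]
  have h3 : (a - d) ^ 2 + (b + c) ^ 2 = 0 := by linear_combination -hn - 2 * h2
  have h4 : a - d = 0 := by
    have := sq_nonneg (b + c)
    exact pow_eq_zero_iff two_ne_zero |>.1 (le_antisymm (by linarith) (sq_nonneg _))
  have h5 : b + c = 0 := by
    have := sq_nonneg (a - d)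
    exact pow_eq_zero_iff two_ne_zero |>.1 (le_antisymm (by linarith) (sq_nonneg _))
  exact ⟨by linarith, by linarith⟩

/-- The inverse of the coordinate `zCoord`. -/
noncomputable def zCoordInv (z : ℂ) : Plane :=
  ![(z.re + z.im / √3) / (2 * Real.pi), -(z.im / (Real.pi * √3))]

theorem zCoord_zCoordInv (z : ℂ) : zCoord (zCoordInv z) = z := by
  have hpi := Real.pi_ne_zero
  have h3 : (√3 : ℝ) ≠ 0 := by positivity
  apply Complex.ext
  · simp [zCoord, zCoordInv]; field_simp; ring
  · simp [zCoord, zCoordInv]; field_simp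

theorem zCoordInv_zCoord (L : Plane) : zCoordInv (zCoord L) = L := by
  have hpi := Real.pi_ne_zero
  have h3 : (√3 : ℝ) ≠ 0 := by positivity
  ext i
  fin_cases i
  · simp [zCoord, zCoordInv]; field_simp; ring
  · simp [zCoord, zCoordInv]; field_simp

theorem hasFDerivAt_zCoordInv_apply (i : Fin 2) (z : ℂ) :
    HasFDerivAt (fun z => zCoordInv z i)
      (![(1 / (2 * Real.pi)), 0] i • Complex.reCLM
        + ![1 / (2 * Real.pi * √3), -(1 / (Real.pi * √3))] i • Complex.imCLM) z := by
  have hre : HasFDerivAt (fun z : ℂ => z.re) Complex.reCLM z := Complex.reCLM.hasFDerivAt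
  have him : HasFDerivAt (fun z : ℂ => z.im) Complex.imCLM z := Complex.imCLM.hasFDerivAt
  have h := (hre.const_mul (![(1 / (2 * Real.pi)), 0] i)).fun_add
    (him.const_mul (![1 / (2 * Real.pi * √3), -(1 / (Real.pi * √3))] i))
  refine h.congr_of_eventuallyEq (Filter.Eventually.of_forall fun w => ?_)
  have hpi := Real.pi_ne_zero
  have h3 : (√3 : ℝ) ≠ 0 := by positivity
  fin_cases i
  · simp [zCoordInv]; field_simp
  · simp [zCoordInv]; field_simp

theorem continuous_zCoordInv : Continuous zCoordInv :=
  continuous_pi fun i => continuous_iff_continuousAt.2 fun z =>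
    (hasFDerivAt_zCoordInv_apply i z).continuousAt

/-- The derivative of `f` in the real direction of the coordinate `z`. -/
noncomputable def zRe (f : Plane → ℝ) (L : Plane) : ℝ := pd 0 f L / (2 * Real.pi)

/-- The derivative of `f` in the imaginary direction of the coordinate `z`. -/
noncomputable def zIm (f : Plane → ℝ) (L : Plane) : ℝ :=
  (pd 0 f L - 2 * pd 1 f L) / (2 * Real.pi * √3)

theorem hasFDerivAt_comp_zCoordInv {f : Plane → ℝ} {z : ℂ}
    (hf : DifferentiableAt ℝ f (zCoordInv z)) : HasFDerivAt (fun z => f (zCoordInv z))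
      (zRe f (zCoordInv z) • Complex.reCLM + zIm f (zCoordInv z) • Complex.imCLM) z := by
  have h := hf.hasFDerivAt.comp z (hasFDerivAt_pi.2 fun i => hasFDerivAt_zCoordInv_apply i z)
  refine h.congr_fderiv ?_
  ext v
  rw [ContinuousLinearMap.comp_apply, fderiv_apply_eq_pd]
  have hpi := Real.pi_ne_zero
  have h3 : (√3 : ℝ) ≠ 0 := by positivity
  simp [zRe, zIm]
  field_simp
  ring

/-- The coordinate `z` is isotropic and conformal for the flat metric. -/
theorem gradientOp_weightMetric (f h : Plane → ℝ) (L : Plane) :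
    gradientOp (fun _ => weightMetric) f h L = 3 * (zRe f L * zRe h L + zIm f L * zIm h L) := by
  have hpi := Real.pi_ne_zero
  have h3 : (√3 : ℝ) ≠ 0 := by positivity
  have h33 : √3 ^ 2 = (3 : ℝ) := Real.sq_sqrt (by norm_num)
  simp [gradientOp, Fin.sum_univ_two, weightMetric, zRe, zIm]
  field_simp
  rw [h33]
  ring

theorem jacobian_zCoord (f h : Plane → ℝ) (L : Plane) :
    zRe f L * zIm h L - zIm f L * zRe h L
      = -(pd 0 f L * pd 1 h L - pd 1 f L * pd 0 h L) / (2 * Real.pi ^ 2 * √3) := by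
  have hpi := Real.pi_ne_zero
  have h3 : (√3 : ℝ) ≠ 0 := by positivity
  simp only [zRe, zIm]
  field_simp
  ring

/-- Separating coordinates of the flat plane would give Liouville coordinates `w` for
which `z` is, locally, a holomorphic function of `w`, contradicting `not_liouville_separable`. -/
theorem not_solvableBySeparation_flat {k : ℝ} (hk0 : k ≠ 0) (hk1 : k ≠ -1) :
    ¬ SolvableBySeparation mirrorComplement (fun _ => weightMetric) (potentialL k) := by
  rintro ⟨W, hWS, ⟨p₀, hp₀⟩, q, hq, hsep⟩
  have hW := hq.1
  have hqs := hq.2.1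
  have hJ := hq.2.2.2.1
  have horth := hq.2.2.2.2
  have hpi := Real.pi_pos
  have h3 : (0 : ℝ) < √3 := by positivity
  have hpos : ∀ p ∈ W, ∀ i, 0 < gradientOp (fun _ => weightMetric) (q i) (q i) p := by
    intro p hp i
    have hj := jacobian_zCoord (q 0) (q 1) p
    have hj0 : zRe (q 0) p * zIm (q 1) p - zIm (q 0) p * zRe (q 1) p ≠ 0 := by
      rw [hj]
      exact div_ne_zero (neg_ne_zero.2 (hJ p hp)) (by positivity)
    rw [gradientOp_weightMetric]
    have hne : zRe (q i) p ≠ 0 ∨ zIm (q i) p ≠ 0 := by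
      by_contra h
      push Not at h
      apply hj0
      fin_cases i
      · simp only [Fin.zero_eta] at h
        rw [h.1, h.2]; ring
      · simp only [Fin.mk_one] at h
        rw [h.1, h.2]; ring
    rcases hne with h | h
    · have := mul_self_pos.2 h
      nlinarith [mul_self_nonneg (zIm (q i) p)]
    · have := mul_self_pos.2 h
      nlinarith [mul_self_nonneg (zRe (q i) p)]
  obtain ⟨W', hW'W, hW', hp₀', β, δ, ρ, F, h, hβ, hall⟩ :=
    exists_liouville_rescaling hq hpos hsep hp₀
  -- the orientation `τ` of the coordinates near `p₀`
  let J : Plane → ℝ := fun p => zRe (q 0) p * zIm (q 1) p - zIm (q 0) p * zRe (q 1) p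
  have hJne : J p₀ ≠ 0 := by
    simp only [J]
    rw [jacobian_zCoord]
    exact div_ne_zero (neg_ne_zero.2 (hJ p₀ hp₀)) (by positivity)
  have hJc : ContinuousAt J p₀ := by
    have hc : ∀ i j, ContinuousAt (pd j (q i)) p₀ := fun i j =>
      (((hqs i).contDiffAt_of_isOpen hW hp₀).pd j).continuousAt
    have hcr : ∀ i, ContinuousAt (zRe (q i)) p₀ := fun i => (hc i 0).div_const _
    have hci : ∀ i, ContinuousAt (zIm (q i)) p₀ := fun i =>
      ((hc i 0).sub (continuousAt_const.mul (hc i 1))).div_const _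
    exact ((hcr 0).mul (hci 1)).sub ((hci 0).mul (hcr 1))
  obtain ⟨τ, hττ, hτJ⟩ : ∃ τ : ℝ, τ * τ = 1 ∧ 0 < τ * J p₀ := by
    rcases lt_or_gt_of_ne hJne with h | h
    · exact ⟨-1, by norm_num, by linarith⟩
    · exact ⟨1, by norm_num, by linarith⟩
  have hev : ∀ᶠ p in 𝓝 p₀, p ∈ W' ∧ 0 < τ * J p :=
    Filter.Eventually.and (hW'.mem_nhds hp₀') ((continuousAt_const.mul hJc).eventually (lt_mem_nhds hτJ))
  obtain ⟨Ω, hΩ, hΩo, hp₀Ω⟩ := eventually_nhds_iff.1 hev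
  -- the holomorphic function `H = β₀(q₀) + i τ β₁(q₁)` of `z`
  let H : ℂ → ℂ := fun z =>
    (β 0 (q 0 (zCoordInv z)) : ℂ) + ((τ * β 1 (q 1 (zCoordInv z)) : ℝ) : ℂ) * Complex.I
  let Ω' : Set ℂ := zCoordInv ⁻¹' Ω
  have hΩ'o : IsOpen Ω' := hΩo.preimage continuous_zCoordInv
  have hderiv : ∀ z ∈ Ω', DifferentiableAt ℂ H z ∧
      Complex.normSq (deriv H z) * (3 * ρ (zCoordInv z)) = 1 := by
    intro z hz
    obtain ⟨hzW', hzJ⟩ := hΩ _ hz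
    have hzW := hW'W hzW'
    obtain ⟨-, hδ, -, -⟩ := hall _ hzW'
    set p := zCoordInv z with hp
    have hd : ∀ i, HasFDerivAt (fun z => β i (q i (zCoordInv z)))
        (δ i (q i p) • (zRe (q i) p • Complex.reCLM + zIm (q i) p • Complex.imCLM)) z := by
      intro i
      have h1 := hasFDerivAt_comp_zCoordInv (z := z)
        ((hqs i).contDiffAt_of_isOpen hW hzW).differentiableAt_infty
      exact (hδ i).1.comp_hasFDerivAt z h1
    have h0 := Complex.ofRealCLM.hasFDerivAt.comp z (hd 0)
    have h1 := Complex.ofRealCLM.hasFDerivAt.comp z ((hd 1).const_mul τ)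
    have hH := h0.add (h1.mul_const Complex.I)
    have hH' : HasFDerivAt H _ z := hH
    obtain ⟨hδ0, hδ0p, hδ0n⟩ := hδ 0
    obtain ⟨hδ1, hδ1p, hδ1n⟩ := hδ 1
    have ho := horth p hzW
    rw [gradientOp_weightMetric] at hδ0n hδ1n ho
    have hcr := cauchyRiemann_of_orthogonal
      (a := δ 0 (q 0 p) * zRe (q 0) p) (b := δ 0 (q 0 p) * zIm (q 0) p)
      (c := τ * (δ 1 (q 1 p) * zRe (q 1) p)) (d := τ * (δ 1 (q 1 p) * zIm (q 1) p))
      (by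
        have hρ : ρ p ≠ 0 := by
          rintro h0; rw [h0, mul_zero] at hδ0n; exact zero_ne_one hδ0n
        have : (3 * ρ p) ≠ 0 := by positivity
        refine mul_right_cancel₀ this ?_
        linear_combination hδ0n - τ * τ * hδ1n - hττ)
      (by linear_combination (τ * δ 0 (q 0 p) * δ 1 (q 1 p) / 3) * ho)
      (by
        have : 0 < δ 0 (q 0 p) * δ 1 (q 1 p) * (τ * J p) := by positivity
        simp only [J] at this
        linarith)
    obtain ⟨c1, c2⟩ := hcr
    have hf1 : fderiv ℝ H z 1 = ⟨δ 0 (q 0 p) * zRe (q 0) p, τ * (δ 1 (q 1 p) * zRe (q 1) p)⟩ := by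
      rw [hH'.fderiv]
      apply Complex.ext <;> simp
    have hfI : fderiv ℝ H z Complex.I
        = ⟨δ 0 (q 0 p) * zIm (q 0) p, τ * (δ 1 (q 1 p) * zIm (q 1) p)⟩ := by
      rw [hH'.fderiv]
      apply Complex.ext <;> simp
    have hdiff : DifferentiableAt ℂ H z := by
      rw [differentiableAt_complex_iff_differentiableAt_real]
      refine ⟨hH'.differentiableAt, ?_⟩
      rw [hf1, hfI]
      apply Complex.ext
      · simp; linarith
      · simpa using c1
    refine ⟨hdiff, ?_⟩
    have : deriv H z = fderiv ℝ H z 1 := by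
      rw [hdiff.fderiv_restrictScalars ℝ]; simp
    rw [this, hf1, Complex.normSq_mk, c2]
    linear_combination hδ0n
  -- its local inverse
  set z₀ := zCoord p₀ with hz₀
  have hz₀Ω : z₀ ∈ Ω' := by
    simp only [Ω', Set.mem_preimage, hz₀, zCoordInv_zCoord]; exact hp₀Ω
  have hHa : AnalyticAt ℂ H z₀ :=
    DifferentiableOn.analyticAt (s := Ω')
      (fun z hz => (hderiv z hz).1.differentiableWithinAt) (hΩ'o.mem_nhds hz₀Ω)
  have hne : ∀ z ∈ Ω', deriv H z ≠ 0 := by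
    intro z hz h0
    have := (hderiv z hz).2
    rw [h0, map_zero, zero_mul] at this
    exact zero_ne_one this
  set Z := hHa.hasStrictDerivAt.localInverse _ _ _ (hne z₀ hz₀Ω) with hZ
  have hZa : AnalyticAt ℂ Z (H z₀) := hHa.analyticAt_localInverse (hne z₀ hz₀Ω)
  have hZ₀ : Z (H z₀) = z₀ := HasStrictFDerivAt.localInverse_apply_image ..
  have hZr : ∀ᶠ w in 𝓝 (H z₀), H (Z w) = w :=
    hHa.hasStrictDerivAt.eventually_right_inverse (hne z₀ hz₀Ω)
  have hZΩ : ∀ᶠ w in 𝓝 (H z₀), Z w ∈ Ω' :=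
    hZa.continuousAt.eventually (by rw [hZ₀]; exact hΩ'o.mem_nhds hz₀Ω)
  obtain ⟨O, hO, hOo, hwO⟩ := eventually_nhds_iff.1
    ((hZa.eventually_analyticAt.and hZr).and hZΩ)
  have hprod : ∀ w ∈ O, deriv H (Z w) * deriv Z w = 1 := by
    intro w hw
    have h1 := (hderiv _ (hO w hw).2).1.hasDerivAt.comp w
      (hO w hw).1.1.differentiableAt.hasDerivAt
    refine h1.unique ((hasDerivAt_id w).congr_of_eventuallyEq ?_)
    filter_upwards [hOo.mem_nhds hw] with x hx
    exact (hO x hx).1.2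
  have hnorm : ∀ w ∈ O, Complex.normSq (deriv Z w) = 3 * ρ (zCoordInv (Z w)) := by
    intro w hw
    have h1 := congrArg Complex.normSq (hprod w hw)
    rw [map_mul, map_one] at h1
    have h2 := (hderiv _ (hO w hw).2).2
    have h4 : Complex.normSq (deriv H (Z w)) ≠ 0 :=
      (Complex.normSq_pos.2 (hne _ (hO w hw).2)).ne'
    exact mul_left_cancel₀ h4 (h1.trans h2.symm)
  have hβinv : ∀ i s, Function.invFun (β i) (β i s) = s := fun i s =>
    Function.leftInverse_invFun (hβ i) s
  have hq0 : ∀ w ∈ O, Function.invFun (β 0) w.re = q 0 (zCoordInv (Z w)) := by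
    intro w hw
    have := congrArg Complex.re (hO w hw).1.2
    simp [H] at this
    rw [← this, hβinv]
  have hq1 : ∀ w ∈ O, Function.invFun (β 1) (τ * w.im) = q 1 (zCoordInv (Z w)) := by
    intro w hw
    have := congrArg Complex.im (hO w hw).1.2
    simp [H] at this
    rw [← this, ← mul_assoc, hττ, one_mul, hβinv]
  refine not_liouville_separable hk0 hk1 hOo ⟨_, hwO⟩ (Z := Z)
    (fun w hw => (hO w hw).1.1.differentiableAt.differentiableWithinAt)
    (fun w hw h0 => by
      have := hprod w hw
      rw [h0, mul_zero] at this
      exact zero_ne_one this)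
    (fun w hw j => ?_)
    (F₀ := fun x => 3 * F 0 (Function.invFun (β 0) x))
    (F₁ := fun y => 3 * F 1 (Function.invFun (β 1) (τ * y)))
    (h₀ := fun x => 3 * h 0 (Function.invFun (β 0) x))
    (h₁ := fun y => 3 * h 1 (Function.invFun (β 1) (τ * y))) (fun w hw => ?_) (fun w hw => ?_)
  · have hmem := hWS (hW'W (hΩ _ (hO w hw).2).1)
    have := sin_zCoord_ne_zero hmem j
    rwa [zCoord_zCoordInv] at this
  · obtain ⟨-, -, h1, -⟩ := hall _ (hΩ _ (hO w hw).2).1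
    rw [hnorm w hw, hq0 w hw, hq1 w hw, h1]; ring
  · obtain ⟨-, -, -, h1⟩ := hall _ (hΩ _ (hO w hw).2).1
    have hV : potentialZ k (Z w) = potentialL k (zCoordInv (Z w)) := by
      rw [← potentialZ_zCoord, zCoord_zCoordInv]
    rw [hnorm w hw, hq0 w hw, hq1 w hw, hV]
    linear_combination 3 * h1

/-! ### Consequences for Turbiner's conjecture -/

theorem not_solvableBySeparation_deltoid {k : ℝ} (hk0 : k ≠ 0) (hk1 : k ≠ -1) :
    ¬ SolvableBySeparation deltoidDomain deltoidMetric (potentialUV k) :=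
  fun h => not_solvableBySeparation_flat hk0 hk1 h.comp_characterMap

theorem contDiff_deltoidMetric (i j : Fin 2) : ContDiff ℝ ∞ fun p => deltoidMetric p i j := by
  fin_cases i <;> fin_cases j <;> simp [deltoidMetric] <;> fun_prop

theorem not_turbinerConjecture {k : ℝ} (hk0 : k ≠ 0) (hk1 : k ≠ -1) : ¬ TurbinerConjecture :=
  fun h => not_solvableBySeparation_deltoid hk0 hk1
    (h deltoidDomain deltoidMetric (potentialUV k) 6
      (fun a => (affineGenerators a).gauge (gaugeFactor k)) isOpen_deltoidDomain
      isConnected_deltoidDomain (fun i j => (contDiff_deltoidMetric i j).contDiffOn)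
      (fun _ hp => deltoidMetric_posDef hp) (contDiffOn_potentialUV k)
      (isLieAlgebraicOver_schrodinger k) isFlatOn_deltoid)

theorem mainTheorem2 (k : ℝ) (hk0 : k ≠ 0) (hk1 : k ≠ -1) :
    -- the affine algebra `a₂` is a Lie algebra of vector fields that acts primitively
    (GeneratesLieAlgebra Set.univ affineGenerators ∧
      ∀ D : Set Plane, IsOpen D → D.Nonempty → ¬ ActsImprimitivelyOn D affineGenerators) ∧
    -- the metric is positive definite and flat inside the deltoid
    (IsOpen deltoidDomain ∧ IsConnected deltoidDomain ∧
      (∀ p ∈ deltoidDomain, (deltoidMetric p).PosDef) ∧ IsFlatOn deltoidDomain deltoidMetric) ∧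
    -- `H₀` is Lie-algebraic over `a₂`
    IsLieAlgebraicOver deltoidDomain affineGenerators (hamiltonianZero k) ∧
    -- `H₀` is gauge-equivalent to the Schrödinger operator `-Δ + U`
    (∀ f : Plane → ℝ, ContDiffOn ℝ ∞ f deltoidDomain → ∀ p ∈ deltoidDomain,
      (gaugeFactor k p)⁻¹ * hamiltonianZero k (fun x => gaugeFactor k x * f x) p
        = schrodinger deltoidMetric (potentialUV k) f p) ∧
    -- hence `-Δ + U` is Lie-algebraic over the gauge-transformed realization of `a₂`
    IsLieAlgebraicOver deltoidDomain
      (fun a => (affineGenerators a).gauge (gaugeFactor k))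
      (schrodinger deltoidMetric (potentialUV k)) ∧
    -- `(L₁, L₂) ↦ (u, v)` is a local isometry of the complement of the mirrors onto the inside of
    -- the deltoid, and carries one form of the potential to the other
    (characterMap '' mirrorComplement = deltoidDomain ∧
      (∀ L : Plane, ∀ a b : Fin 2,
        (∑ i, ∑ j, weightMetric i j * pd i (fun x => characterMap x a) L
            * pd j (fun x => characterMap x b) L) = deltoidMetric (characterMap L) a b) ∧
      (∀ L ∈ mirrorComplement, potentialUV k (characterMap L) = potentialL k L)) ∧
    -- the potential separates in none of the four types of coordinate systems
    (∀ κ : CoordinateType,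
      ¬ SeparatesInType κ weightMetric mirrorComplement (potentialL k)) ∧
    -- the Schrödinger equation cannot be solved by separation of variables
    ¬ SolvableBySeparation mirrorComplement (fun _ => weightMetric) (potentialL k) ∧
    ¬ SolvableBySeparation deltoidDomain deltoidMetric (potentialUV k) ∧
    -- Turbiner's conjecture is false
    ¬ TurbinerConjecture := by
  exact ⟨⟨generatesLieAlgebra_affine isOpen_univ, fun _ _ hD => not_actsImprimitively_affine hD⟩,
    ⟨isOpen_deltoidDomain, isConnected_deltoidDomain, fun _ hp => deltoidMetric_posDef hp,
      isFlatOn_deltoid⟩,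
    isLieAlgebraicOver_hamiltonianZero k,
    fun _ hf _ hp => gauge_hamiltonianZero k hf hp,
    isLieAlgebraicOver_schrodinger k,
    ⟨characterMap_image, characterMap_isometry, fun _ hL => potentialUV_characterMap k hL⟩,
    not_separatesInType hk0 hk1,
    not_solvableBySeparation_flat hk0 hk1,
    not_solvableBySeparation_deltoid hk0 hk1,
    not_turbinerConjecture hk0 hk1⟩
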